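/- Let $M$ be a connected smooth manifold of dimension $m$ with a smooth pseudo-Riemannian metric $g$ of arbitrary signature. Let $\nabla$ be its Levi-Civita connection, let $R(X,Y)Z=\nabla_X\nabla_YZ-\nabla_Y\nabla_XZ-\nabla_{[X,Y]}Z$ and $R(X,Y,Z,W)=g(R(X,Y)Z,W)$ be its curvature, $\rho(Y,Z)=\operatorname{tr}\{X\mapsto R(X,Y)Z\}$ its Ricci tensor, $\operatorname{Ric}$ the Ricci operator, $g(\operatorname{Ric}X,Y)=\rho(X,Y)$, and $\tau$ its scalar curvature. For a smooth function $h$ let $\nabla h=\operatorname{grad}h$ be the gradient, $\operatorname{Hess}_h(X,Y)=X(Y(h))-(\nabla_XY)(h)$ the Hessian and $\mathcal H_h(X)=\nabla_X(\nabla h)$ the Hessian operator. Norms of vectors and tensors are taken with respect to $g$, e.g. $\|\nabla h\|^2=g(\nabla h,\nabla h)$ and $\|\operatorname{Hess}_h\|^2=g^{ik}g^{jl}(\operatorname{Hess}_h)_{ij}(\operatorname{Hess}_h)_{kl}$. Suppose that $f\in C^\infty(M)$ and $\lambda\in\mathbb R$ satisfy the gradient Ricci soliton equation $\operatorname{Hess}_f+\rho=\lambda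 g$ and that $\tau$ is constant. Then: 1. (a) $\operatorname{Ric}(\nabla f)=0$. (b) $\|\nabla f\|^2-2\lambda f$ is constant. (c) $R(X,Y,Z,\nabla f)=(\nabla_X\rho)(Y,Z)-(\nabla_Y\rho)(X,Z)$ for all smooth vector fields $X,Y,Z$. (d) $(\nabla_{\nabla f}\operatorname{Ric})(Y)+\operatorname{Ric}(\mathcal H_f(Y))=R(Y,\nabla f)\nabla f$ for every smooth vector field $Y$. 2. Let $X$ be a Killing vector field on $M$, i.e. $\mathcal L_Xg=0$. Then: (a) $\mathcal L_X(\operatorname{Hess}_f)=\operatorname{Hess}_{X(f)}$. (b) $\operatorname{grad}\{X(f)\}$ is a parallel vector field. (c) If $\lambda\neq0$, then $\operatorname{grad}\{X(f)\}=0$ if and only if $X(f)=0$. 3. $\lambda(m\lambda-\tau)=\|\operatorname{Hess}_f\|^2$. 4. If $\|\nabla f\|^2=0$ on $M$ (the soliton is isotropic) and $\lambda\neq0$ (it is non-steady), then $(M,g)$ is Einstein, with $\rho=\lambda g$. 5. If $\lambda=0$ (the soliton is steady), then $\|\operatorname{Hess}_f\|^2=0$ and $\|\nabla f\|^2$ is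 constant. -/

import Mathlib

open scoped Manifold ContDiff

/-- A smooth pseudo-Riemannian metric, of arbitrary signature, on a smooth manifold `M` without
boundary modelled on the finite-dimensional real vector space `E`: a smooth field of symmetric
non-degenerate bilinear forms on the tangent spaces. -/
structure PseudoRiemannianMetric (E : Type*) [NormedAddCommGroup E] [NormedSpace ℝ E]
    (M : Type*) [TopologicalSpace M] [ChartedSpace E M] [IsManifold 𝓘(ℝ, E) ∞ M] where
  /-- The bilinear form `g_p` on `T_p M`. -/
  inner (p : M) : TangentSpace 𝓘(ℝ, E) p →L[ℝ] TangentSpace 𝓘(ℝ, E) p →L[ℝ] ℝ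
  symm (p : M) (v w : TangentSpace 𝓘(ℝ, E) p) : inner p v w = inner p w v
  nondegenerate (p : M) (v : TangentSpace 𝓘(ℝ, E) p) (hv : ∀ w, inner p v w = 0) : v = 0
  contMDiff : ContMDiff 𝓘(ℝ, E) (𝓘(ℝ, E).prod 𝓘(ℝ, E →L[ℝ] E →L[ℝ] ℝ)) ∞
    (fun p => Bundle.TotalSpace.mk' (E →L[ℝ] E →L[ℝ] ℝ)
      (E := fun q : M => TangentSpace 𝓘(ℝ, E) q →L[ℝ] TangentSpace 𝓘(ℝ, E) q →L[ℝ] ℝ) p (inner p))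

namespace PseudoRiemannianMetric

noncomputable section

section fields

variable {E : Type*} [NormedAddCommGroup E] [NormedSpace ℝ E]
  {M : Type*} [TopologicalSpace M] [ChartedSpace E M]

/-- The vector field `X` is smooth. -/
def IsSmoothField [IsManifold 𝓘(ℝ, E) ∞ M] (X : Π p : M, TangentSpace 𝓘(ℝ, E) p) : Prop :=
  ContMDiff 𝓘(ℝ, E) (𝓘(ℝ, E).prod 𝓘(ℝ, E)) ∞
    (fun p => (Bundle.TotalSpace.mk' E p (X p) : TangentBundle 𝓘(ℝ, E) M))

/-- The function `X(f)`, the derivative of `f` along the vector field `X`. -/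
def dirDeriv (X : Π p : M, TangentSpace 𝓘(ℝ, E) p) (f : M → ℝ) : M → ℝ :=
  fun p => mvfderiv 𝓘(ℝ, E) f p (X p)

/-- A vector field with value `v` at `p` which is smooth near `p`. The tensors below are evaluated
on tangent vectors at `p` by extending these to such fields. -/
def ext [IsManifold 𝓘(ℝ, E) ∞ M] {p : M} (v : TangentSpace 𝓘(ℝ, E) p) :
    Π q : M, TangentSpace 𝓘(ℝ, E) q :=
  FiberBundle.extend E v

/-- The Lie derivative `(L_X T)(Y, Z) = X(T(Y, Z)) - T([X, Y], Z) - T(Y, [X, Z])` of a field `T` of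
bilinear forms. -/
def lieDeriv (T : Π p : M, TangentSpace 𝓘(ℝ, E) p → TangentSpace 𝓘(ℝ, E) p → ℝ)
    (X Y Z : Π p : M, TangentSpace 𝓘(ℝ, E) p) (p : M) : ℝ :=
  dirDeriv X (fun q => T q (Y q) (Z q)) p
    - T p (VectorField.mlieBracket 𝓘(ℝ, E) X Y p) (Z p)
    - T p (Y p) (VectorField.mlieBracket 𝓘(ℝ, E) X Z p)

end fields

variable {E : Type*} [NormedAddCommGroup E] [NormedSpace ℝ E]
  {M : Type*} [TopologicalSpace M] [ChartedSpace E M] [IsManifold 𝓘(ℝ, E) ∞ M]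
  (g : PseudoRiemannianMetric E M)

open Classical in
/-- The vector metrically dual to a linear form `φ` on `T_p M`: the unique `u` such that
`g(u, w) = φ(w)` for all `w`. (It exists for every linear `φ`; for other functions `φ` the value
is irrelevant.) -/
def sharp (p : M) (φ : TangentSpace 𝓘(ℝ, E) p → ℝ) : TangentSpace 𝓘(ℝ, E) p :=
  if h : ∃ u : TangentSpace 𝓘(ℝ, E) p, ∀ w, g.inner p u w = φ w then h.choose else 0

/-- The function `g(X, Y)`. -/
def pair (X Y : Π p : M, TangentSpace 𝓘(ℝ, E) p) : M → ℝ :=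
  fun p => g.inner p (X p) (Y p)

/-- The Koszul expression, which is twice `g(∇_X Y, Z)`. -/
def koszul (X Y Z : Π p : M, TangentSpace 𝓘(ℝ, E) p) (p : M) : ℝ :=
  dirDeriv X (g.pair Y Z) p + dirDeriv Y (g.pair X Z) p - dirDeriv Z (g.pair X Y) p
    + g.inner p (VectorField.mlieBracket 𝓘(ℝ, E) X Y p) (Z p)
    - g.inner p (VectorField.mlieBracket 𝓘(ℝ, E) X Z p) (Y p)
    - g.inner p (VectorField.mlieBracket 𝓘(ℝ, E) Y Z p) (X p)

/-- The Levi-Civita covariant derivative `∇_v Y` of a vector field `Y` in the direction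
`v ∈ T_p M`, given by the Koszul formula. -/
def nabla (Y : Π p : M, TangentSpace 𝓘(ℝ, E) p) (p : M) (v : TangentSpace 𝓘(ℝ, E) p) :
    TangentSpace 𝓘(ℝ, E) p :=
  g.sharp p (fun w => g.koszul (ext v) Y (ext w) p / 2)

/-- The vector field `∇_X Y`. -/
def cov (X Y : Π p : M, TangentSpace 𝓘(ℝ, E) p) : Π p : M, TangentSpace 𝓘(ℝ, E) p :=
  fun p => g.nabla Y p (X p)

/-- The curvature `R(X, Y) Z = ∇_X ∇_Y Z - ∇_Y ∇_X Z - ∇_{[X, Y]} Z` on vector fields. -/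
def curvature (X Y Z : Π p : M, TangentSpace 𝓘(ℝ, E) p) : Π p : M, TangentSpace 𝓘(ℝ, E) p :=
  fun p => g.cov X (g.cov Y Z) p - g.cov Y (g.cov X Z) p
    - g.nabla Z p (VectorField.mlieBracket 𝓘(ℝ, E) X Y p)

/-- The curvature tensor on tangent vectors at `p`. -/
def curvatureAt (p : M) (u v w : TangentSpace 𝓘(ℝ, E) p) : TangentSpace 𝓘(ℝ, E) p :=
  g.curvature (ext u) (ext v) (ext w) p

/-- The gradient of `f`, the vector field dual to `df`. -/
def grad (f : M → ℝ) : Π p : M, TangentSpace 𝓘(ℝ, E) p :=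
  fun p => g.sharp p (fun w => mvfderiv 𝓘(ℝ, E) f p w)

/-- The Hessian `Hess_f(X, Y) = X(Y(f)) - (∇_X Y)(f)`, on tangent vectors at `p`. -/
def hess (f : M → ℝ) (p : M) (v w : TangentSpace 𝓘(ℝ, E) p) : ℝ :=
  mvfderiv 𝓘(ℝ, E) (dirDeriv (ext w) f) p v - mvfderiv 𝓘(ℝ, E) f p (g.nabla (ext w) p v)

/-- The Hessian operator `H_f(v) = ∇_v (∇f)`. -/
def hessOp (f : M → ℝ) (p : M) (v : TangentSpace 𝓘(ℝ, E) p) : TangentSpace 𝓘(ℝ, E) p :=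
  g.nabla (g.grad f) p v

/-- `X` is a (smooth) Killing vector field: `L_X g = 0`. -/
def IsKilling (X : Π p : M, TangentSpace 𝓘(ℝ, E) p) : Prop :=
  IsSmoothField X ∧ ∀ Y Z : Π p : M, TangentSpace 𝓘(ℝ, E) p, IsSmoothField Y → IsSmoothField Z →
    ∀ p, lieDeriv (fun q v w => g.inner q v w) X Y Z p = 0

/-- The vector field `Y` is parallel: `∇Y = 0`. -/
def IsParallel (Y : Π p : M, TangentSpace 𝓘(ℝ, E) p) : Prop :=
  ∀ (p : M) (v : TangentSpace 𝓘(ℝ, E) p), g.nabla Y p v = 0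

variable [FiniteDimensional ℝ E]

/-- A basis of `T_p M` (which is `E` as a vector space), used to write traces and metric
contractions. -/
def frame (E : Type*) [NormedAddCommGroup E] [NormedSpace ℝ E] [FiniteDimensional ℝ E]
    {M : Type*} [TopologicalSpace M] [ChartedSpace E M] (p : M) :
    Module.Basis (Fin (Module.finrank ℝ E)) ℝ (TangentSpace 𝓘(ℝ, E) p) :=
  (Module.finBasis ℝ E : Module.Basis (Fin (Module.finrank ℝ E)) ℝ E)

/-- The reciprocal basis of `T_p M`: the vectors `e^i` with `g(e^i, e_j) = δ_ij`. -/
def coframe (p : M) (i : Fin (Module.finrank ℝ E)) : TangentSpace 𝓘(ℝ, E) p :=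
  g.sharp p (fun w => (frame E p).repr w i)

/-- The Ricci tensor `ρ(v, w) = trace (u ↦ R(u, v) w)`. -/
def ricci (p : M) (v w : TangentSpace 𝓘(ℝ, E) p) : ℝ :=
  ∑ i, (frame E p).repr (g.curvatureAt p (frame E p i) v w) i

/-- The Ricci operator, `g(Ric v, w) = ρ(v, w)`. -/
def ricciOp (p : M) (v : TangentSpace 𝓘(ℝ, E) p) : TangentSpace 𝓘(ℝ, E) p :=
  g.sharp p (fun w => g.ricci p v w)

/-- The scalar curvature `τ`, the metric trace of the Ricci tensor. -/
def scalarCurvature (p : M) : ℝ :=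
  ∑ i, g.ricci p (frame E p i) (g.coframe p i)

/-- The square norm `‖T‖² = g^{ik} g^{jl} T_{ij} T_{kl}` of a bilinear form `T` on `T_p M`. -/
def normSq₂ (p : M) (T : TangentSpace 𝓘(ℝ, E) p → TangentSpace 𝓘(ℝ, E) p → ℝ) : ℝ :=
  ∑ i, ∑ j, T (frame E p i) (frame E p j) * T (g.coframe p i) (g.coframe p j)

/-- The covariant derivative of the Ricci tensor:
`(∇_X ρ)(Y, Z) = X(ρ(Y, Z)) - ρ(∇_X Y, Z) - ρ(Y, ∇_X Z)`. -/
def covRicci (X Y Z : Π p : M, TangentSpace 𝓘(ℝ, E) p) (p : M) : ℝ :=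
  dirDeriv X (fun q => g.ricci q (Y q) (Z q)) p
    - g.ricci p (g.cov X Y p) (Z p) - g.ricci p (Y p) (g.cov X Z p)

/-- The covariant derivative of the Ricci operator:
`(∇_X Ric) Y = ∇_X (Ric Y) - Ric (∇_X Y)`. -/
def covRicciOp (X Y : Π p : M, TangentSpace 𝓘(ℝ, E) p) (p : M) : TangentSpace 𝓘(ℝ, E) p :=
  g.cov X (fun q => g.ricciOp q (Y q)) p - g.ricciOp p (g.cov X Y p)

/-- `(M, g, f)` is a gradient Ricci soliton with constant `c`: `Hess_f + ρ = c g`, `f` smooth. -/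
structure IsGradientRicciSoliton (f : M → ℝ) (c : ℝ) : Prop where
  contMDiff : ContMDiff 𝓘(ℝ, E) 𝓘(ℝ, ℝ) ∞ f
  eq (p : M) (v w : TangentSpace 𝓘(ℝ, E) p) : g.hess f p v w + g.ricci p v w = c * g.inner p v w

/-- `g` is Einstein with Einstein constant `c`: `ρ = c g`. -/
def IsEinstein (c : ℝ) : Prop :=
  ∀ (p : M) (v w : TangentSpace 𝓘(ℝ, E) p), g.ricci p v w = c * g.inner p v w

end

end PseudoRiemannianMetric

/-!
The Koszul formula makes `∇` a metric, torsion-free connection, and the smooth vector fields with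
`∇` and the bracket form a Lie ring with a connection (`SmoothField`, `conn`). There the second
Bianchi identity (`second_bianchi`) and the invariance of connection and curvature under a Killing
field (`lie_conn`, `lie_curv`) are formal. Contractions are taken with smooth local dual frames;
`dirDeriv_trace` says that a derivation compatible with the metric commutes with traces of fields
of endomorphisms. With `∇_X` for the derivation it gives the contracted Bianchi identity
`2 div ρ = dτ`, with the bracket by a Killing field it gives `L_X ρ = 0`.

On a soliton `Ric = λ - H_f`, so that `(∇_X Ric) Y - (∇_Y Ric) X = -R(X, Y) ∇f`
(`covSolitonOp_sub`). Contracting, `ρ(Y, ∇f) = Y(τ) - div ρ (Y) = 0` for constant `τ`, hence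
`Ric ∇f = 0` (`solitonOp_gradField`) and `∇_{∇f} ∇f = λ ∇f`. The latter is
`d (‖∇f‖² - 2 λ f) = 0`, and setting `X = ∇f` above gives
`∇_{∇f} Ric + Ric ∘ H_f = R(·, ∇f) ∇f`. The trace of this identity is `tr (Ric ∘ H_f) = 0`, as
`∇f (τ) = 0` and `ρ(∇f, ∇f) = 0`; so `‖Hess_f‖² = tr H_f² = λ tr H_f = λ (m λ - τ)`.

A Killing field `X` preserves `g`, `∇` and `ρ`, so `[X, ∇f] = ∇(X f)` and
`Hess_{X f} = L_X Hess_f = L_X (λ g - ρ) = 0`. If `∇(X f) = 0`, differentiating the constant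
`‖∇f‖² - 2 λ f` along `X` leaves `2 λ X f = 0`.
-/

open scoped Manifold ContDiff
open Bundle Filter Topology Manifold
open FiberBundle (exists_contMDiffOn_extend mdifferentiableAt_extend)

/-! ### Derivations, brackets and extensions of vector fields -/

namespace PseudoRiemannianMetric

section fields

variable {E : Type*} [NormedAddCommGroup E] [NormedSpace ℝ E]
  {M : Type*} [TopologicalSpace M] [ChartedSpace E M]

lemma dirDeriv_congr {X X' : Π p : M, TangentSpace 𝓘(ℝ, E) p} {f f' : M → ℝ} {p : M}
    (hX : X p = X' p) (hf : f =ᶠ[𝓝 p] f') : dirDeriv X f p = dirDeriv X' f' p := by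
  simp only [dirDeriv, mvfderiv, hX, hf.mfderiv_eq]
  rfl

lemma dirDeriv_add {X : Π p : M, TangentSpace 𝓘(ℝ, E) p} {f f' : M → ℝ} {p : M}
    (hf : MDiffAt f p) (hf' : MDiffAt f' p) :
    dirDeriv X (f + f') p = dirDeriv X f p + dirDeriv X f' p := by
  simp [dirDeriv, mvfderiv_add hf hf']

lemma dirDeriv_mul {X : Π p : M, TangentSpace 𝓘(ℝ, E) p} {f f' : M → ℝ} {p : M}
    (hf : MDiffAt f p) (hf' : MDiffAt f' p) :
    dirDeriv X (f * f') p = dirDeriv X f p * f' p + f p * dirDeriv X f' p := by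
  simp [dirDeriv, mvfderiv_mul hf hf']; ring

variable [IsManifold 𝓘(ℝ, E) ∞ M]

lemma IsSmoothField.mdifferentiableAt {X : Π p : M, TangentSpace 𝓘(ℝ, E) p}
    (hX : IsSmoothField X) (p : M) : MDiffAt (T% X) p :=
  (ContMDiff.mdifferentiable hX (by simp)) p

lemma IsSmoothField.mlieBracket [CompleteSpace E] {X Y : Π p : M, TangentSpace 𝓘(ℝ, E) p}
    (hX : IsSmoothField X) (hY : IsSmoothField Y) :
    IsSmoothField (VectorField.mlieBracket 𝓘(ℝ, E) X Y) := by
  have : IsManifold 𝓘(ℝ, E) (((⊤ : ℕ∞) : WithTop ℕ∞) + 1) M := by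
    simpa using (inferInstance : IsManifold 𝓘(ℝ, E) ∞ M)
  have : IsManifold 𝓘(ℝ, E) (minSmoothness ℝ 2) M := by
    simp only [minSmoothness_of_isRCLikeNormedField]; infer_instance
  exact ContDiff.mlieBracket_vectorField (m := ⊤) (n := ⊤) hX hY (by simp)

lemma dirDeriv_contMDiff {X : Π p : M, TangentSpace 𝓘(ℝ, E) p} (hX : IsSmoothField X)
    {f : M → ℝ} (hf : ContMDiff 𝓘(ℝ, E) 𝓘(ℝ, ℝ) ∞ f) :
    ContMDiff 𝓘(ℝ, E) 𝓘(ℝ, ℝ) ∞ (dirDeriv X f) :=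
  ((contMDiff_snd_tangentBundle_modelSpace ℝ 𝓘(ℝ, ℝ)).comp
    (hf.contMDiff_tangentMap (m := ∞) (by simp))).comp hX

@[simp] lemma ext_self {p : M} (v : TangentSpace 𝓘(ℝ, E) p) : ext v p = v := by
  simp [ext]

lemma ext_mdifferentiableAt [FiniteDimensional ℝ E] {p : M} (v : TangentSpace 𝓘(ℝ, E) p) :
    MDiffAt (T% (ext v)) p :=
  mdifferentiableAt_extend 𝓘(ℝ, E) E v

/-- A vector field which is smooth near `p` agrees near `p` with a globally smooth one. -/
lemma exists_isSmoothField_eventuallyEq [FiniteDimensional ℝ E] [T2Space M]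
    {p : M} {X : Π p : M, TangentSpace 𝓘(ℝ, E) p} {u : Set M} (hu : u ∈ 𝓝 p)
    (hX : CMDiff[u] ∞ (T% X)) :
    ∃ Y : Π p : M, TangentSpace 𝓘(ℝ, E) p, IsSmoothField Y ∧ Y =ᶠ[𝓝 p] X := by
  obtain ⟨v, hvu, hv, hpv⟩ := mem_nhds_iff.1 hu
  obtain ⟨φ, -, hφ⟩ := (SmoothBumpFunction.nhds_basis_tsupport (I := 𝓘(ℝ, E)) p).mem_iff.1
    (hv.mem_nhds hpv)
  refine ⟨(φ : M → ℝ) • X, ContMDiffOn.smul_section_of_tsupport φ.contMDiff.contMDiffOn hv hφ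
    (hX.mono hvu), ?_⟩
  filter_upwards [φ.eventuallyEq_one] with q hq
  simp [hq]
  rfl

lemma exists_isSmoothField_ext [FiniteDimensional ℝ E] [T2Space M] {p : M}
    (v : TangentSpace 𝓘(ℝ, E) p) :
    ∃ Y : Π p : M, TangentSpace 𝓘(ℝ, E) p, IsSmoothField Y ∧ Y =ᶠ[𝓝 p] ext v := by
  obtain ⟨s, hs, hs'⟩ := exists_contMDiffOn_extend (k := ∞) 𝓘(ℝ, E) E v
  exact exists_isSmoothField_eventuallyEq hs hs'

lemma exists_isSmoothField_apply_eq [FiniteDimensional ℝ E] [T2Space M] {p : M}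
    (v : TangentSpace 𝓘(ℝ, E) p) :
    ∃ Y : Π p : M, TangentSpace 𝓘(ℝ, E) p, IsSmoothField Y ∧ Y p = v := by
  obtain ⟨Y, hY, h⟩ := exists_isSmoothField_ext v
  exact ⟨Y, hY, by simp [h.eq_of_nhds]⟩

/-- The Lie bracket of vector fields acts on functions as the commutator of derivations. The
Jacobi identity for `X`, `Y` and `f • Z` reduces to this identity times `Z`. -/
lemma dirDeriv_mlieBracket [FiniteDimensional ℝ E] [T2Space M]
    {X Y : Π p : M, TangentSpace 𝓘(ℝ, E) p} (hX : IsSmoothField X) (hY : IsSmoothField Y)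
    {f : M → ℝ} (hf : ContMDiff 𝓘(ℝ, E) 𝓘(ℝ, ℝ) ∞ f) (p : M) :
    dirDeriv (VectorField.mlieBracket 𝓘(ℝ, E) X Y) f p
      = dirDeriv X (dirDeriv Y f) p - dirDeriv Y (dirDeriv X f) p := by
  have : CompleteSpace E := FiniteDimensional.complete ℝ E
  have hmd {h : M → ℝ} (hh : ContMDiff 𝓘(ℝ, E) 𝓘(ℝ, ℝ) ∞ h) (q : M) : MDiffAt h q :=
    (hh.mdifferentiable (by simp)) q
  suffices H : ∀ v : TangentSpace 𝓘(ℝ, E) p,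
      (dirDeriv (VectorField.mlieBracket 𝓘(ℝ, E) X Y) f p
      - (dirDeriv X (dirDeriv Y f) p - dirDeriv Y (dirDeriv X f) p)) • v = 0 by
    -- if `T_p M = 0` then both sides vanish
    by_cases hv : ∃ v : TangentSpace 𝓘(ℝ, E) p, v ≠ 0
    · obtain ⟨v, hv⟩ := hv
      exact sub_eq_zero.1 ((smul_eq_zero.1 (H v)).resolve_right hv)
    · push Not at hv
      simp [dirDeriv, hv (X p), hv (Y p), hv (VectorField.mlieBracket 𝓘(ℝ, E) X Y p)]
  intro v
  obtain ⟨Z, hZ, hZv⟩ := exists_isSmoothField_apply_eq v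
  have hb {A B : Π p : M, TangentSpace 𝓘(ℝ, E) p} (hB : IsSmoothField B) {h : M → ℝ}
      (hh : ContMDiff 𝓘(ℝ, E) 𝓘(ℝ, ℝ) ∞ h) :
      VectorField.mlieBracket 𝓘(ℝ, E) A (h • B)
        = dirDeriv A h • B + h • VectorField.mlieBracket 𝓘(ℝ, E) A B := by
    funext q
    exact VectorField.mlieBracket_smul_right (hmd hh q) (hB.mdifferentiableAt q)
  have hs {h : M → ℝ} {B : Π p : M, TangentSpace 𝓘(ℝ, E) p}
      (hh : ContMDiff 𝓘(ℝ, E) 𝓘(ℝ, ℝ) ∞ h) (hB : IsSmoothField B) : IsSmoothField (h • B) :=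
    ContMDiff.smul_section hh hB
  have h2 {B : Π p : M, TangentSpace 𝓘(ℝ, E) p} (hB : IsSmoothField B) :
      CMDiff (minSmoothness ℝ 2) (T% B) := by
    simp only [minSmoothness_of_isRCLikeNormedField]
    exact ContMDiff.of_le hB ENat.LEInfty.out
  have h3 : IsManifold 𝓘(ℝ, E) (minSmoothness ℝ 3) M := by
    simp only [minSmoothness_of_isRCLikeNormedField]; infer_instance
  have J := VectorField.leibniz_identity_mlieBracket (h2 hX) (h2 hY) (h2 (hs hf hZ))
  have J' := VectorField.leibniz_identity_mlieBracket (h2 hX) (h2 hY) (h2 hZ)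
  have ha {A B C : Π p : M, TangentSpace 𝓘(ℝ, E) p} (hB : IsSmoothField B)
      (hC : IsSmoothField C) :
      VectorField.mlieBracket 𝓘(ℝ, E) A (B + C) = VectorField.mlieBracket 𝓘(ℝ, E) A B
        + VectorField.mlieBracket 𝓘(ℝ, E) A C := by
    funext q
    exact VectorField.mlieBracket_add_right (hB.mdifferentiableAt q) (hC.mdifferentiableAt q)
  have hXf := dirDeriv_contMDiff hX hf
  have hYf := dirDeriv_contMDiff hY hf
  rw [hb hZ hf, hb hZ hf, hb hZ hf, ha (hs hYf hZ) (hs hf (hY.mlieBracket hZ)),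
    ha (hs hXf hZ) (hs hf (hX.mlieBracket hZ)), hb hZ hYf, hb hZ hXf, hb (hY.mlieBracket hZ) hf,
    hb (hX.mlieBracket hZ) hf, J'] at J
  have Jp := congrFun J p
  simp only [Pi.add_apply, Pi.smul_apply', hZv] at Jp
  rw [sub_smul, sub_smul]
  linear_combination (norm := module) (-1 : ℝ) • Jp

end fields

end PseudoRiemannianMetric

/-! ### The Koszul formula and the Levi-Civita connection -/

namespace PseudoRiemannianMetric

section pointwise

variable {E : Type*} [NormedAddCommGroup E] [NormedSpace ℝ E]
  {M : Type*} [TopologicalSpace M] [ChartedSpace E M] [IsManifold 𝓘(ℝ, E) ∞ M]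
  (g : PseudoRiemannianMetric E M)

lemma pair_contMDiffAt {X Y : Π p : M, TangentSpace 𝓘(ℝ, E) p} {p : M}
    (hX : CMDiffAt ∞ (T% X) p) (hY : CMDiffAt ∞ (T% Y) p) : CMDiffAt ∞ (g.pair X Y) p := by
  have : ContMDiffAt 𝓘(ℝ, E) (𝓘(ℝ, E).prod 𝓘(ℝ)) ∞
      (fun m ↦ TotalSpace.mk' ℝ (E := Bundle.Trivial M ℝ) m (g.inner m (X m) (Y m))) p :=
    ContMDiffAt.clm_bundle_apply₂ (F₁ := E) (F₂ := E) (b := id) (g.contMDiff p) hX hY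
  simp only [contMDiffAt_totalSpace] at this
  exact this.2

lemma pair_contMDiff {X Y : Π p : M, TangentSpace 𝓘(ℝ, E) p}
    (hX : IsSmoothField X) (hY : IsSmoothField Y) : CMDiff ∞ (g.pair X Y) :=
  fun p => g.pair_contMDiffAt (hX p) (hY p)

lemma pair_mdifferentiableAt {X Y : Π p : M, TangentSpace 𝓘(ℝ, E) p} {p : M}
    (hX : MDiffAt (T% X) p) (hY : MDiffAt (T% Y) p) : MDiffAt (g.pair X Y) p := by
  have : MDifferentiableAt 𝓘(ℝ, E) (𝓘(ℝ, E).prod 𝓘(ℝ))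
      (fun m ↦ TotalSpace.mk' ℝ (E := Bundle.Trivial M ℝ) m (g.inner m (X m) (Y m))) p :=
    MDifferentiableAt.clm_bundle_apply₂ (F₁ := E) (F₂ := E) (b := id)
      (g.contMDiff.mdifferentiable (by simp) p) hX hY
  simp only [mdifferentiableAt_totalSpace] at this
  exact this.2

lemma eq_of_inner_eq {p : M} {u u' : TangentSpace 𝓘(ℝ, E) p}
    (h : ∀ w, g.inner p u w = g.inner p u' w) : u = u' :=
  sub_eq_zero.1 (g.nondegenerate p _ fun w => by simp [h w])

lemma pair_comm (X Y : Π p : M, TangentSpace 𝓘(ℝ, E) p) : g.pair X Y = g.pair Y X :=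
  funext fun p => g.symm p _ _

lemma pair_add_left (X X' Y : Π p : M, TangentSpace 𝓘(ℝ, E) p) :
    g.pair (X + X') Y = g.pair X Y + g.pair X' Y := by
  funext p; simp [pair]

lemma pair_add_right (X Y Y' : Π p : M, TangentSpace 𝓘(ℝ, E) p) :
    g.pair X (Y + Y') = g.pair X Y + g.pair X Y' := by
  funext p; simp [pair]

lemma pair_smul_left (f : M → ℝ) (X Y : Π p : M, TangentSpace 𝓘(ℝ, E) p) :
    g.pair (f • X) Y = f * g.pair X Y := by
  funext p; simp [pair]

lemma pair_smul_right (f : M → ℝ) (X Y : Π p : M, TangentSpace 𝓘(ℝ, E) p) :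
    g.pair X (f • Y) = f * g.pair X Y := by
  funext p; simp [pair]

lemma koszul_congr {X Y Z X' Y' Z' : Π p : M, TangentSpace 𝓘(ℝ, E) p} {p : M}
    (hX : X =ᶠ[𝓝 p] X') (hY : Y =ᶠ[𝓝 p] Y') (hZ : Z =ᶠ[𝓝 p] Z') :
    g.koszul X Y Z p = g.koszul X' Y' Z' p := by
  have hp {A B A' B' : Π p : M, TangentSpace 𝓘(ℝ, E) p} (hA : A =ᶠ[𝓝 p] A')
      (hB : B =ᶠ[𝓝 p] B') : g.pair A B =ᶠ[𝓝 p] g.pair A' B' := by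
    filter_upwards [hA, hB] with q h1 h2
    simp [pair, h1, h2]
  simp only [koszul, dirDeriv_congr hX.eq_of_nhds (hp hY hZ),
    dirDeriv_congr hY.eq_of_nhds (hp hX hZ), dirDeriv_congr hZ.eq_of_nhds (hp hX hY),
    hX.mlieBracket_vectorField_eq hY, hX.mlieBracket_vectorField_eq hZ,
    hY.mlieBracket_vectorField_eq hZ, hX.eq_of_nhds, hY.eq_of_nhds, hZ.eq_of_nhds]

/-- The covariant derivative `∇_v Y` depends only on the germ of `Y`. -/
lemma nabla_congr {Y Y' : Π p : M, TangentSpace 𝓘(ℝ, E) p} {p : M} (hY : Y =ᶠ[𝓝 p] Y')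
    (v : TangentSpace 𝓘(ℝ, E) p) : g.nabla Y p v = g.nabla Y' p v := by
  unfold nabla
  congr 1
  funext w
  exact congrArg (· / 2) (g.koszul_congr (.refl _ _) hY (.refl _ _))

variable [FiniteDimensional ℝ E]

/-- On a finite-dimensional tangent space every linear form is represented by a vector. -/
lemma inner_sharp {p : M} {φ : TangentSpace 𝓘(ℝ, E) p → ℝ} (hφ : IsLinearMap ℝ φ)
    (w : TangentSpace 𝓘(ℝ, E) p) : g.inner p (g.sharp p φ) w = φ w := by
  have : FiniteDimensional ℝ (TangentSpace 𝓘(ℝ, E) p) := inferInstanceAs (FiniteDimensional ℝ E)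
  let L : TangentSpace 𝓘(ℝ, E) p →ₗ[ℝ] Module.Dual ℝ (TangentSpace 𝓘(ℝ, E) p) :=
    { toFun := fun v => (g.inner p v : TangentSpace 𝓘(ℝ, E) p →ₗ[ℝ] ℝ)
      map_add' := fun v w => by ext; simp
      map_smul' := fun c v => by ext; simp }
  have hinj : Function.Injective L := fun v w h =>
    g.eq_of_inner_eq fun x => LinearMap.congr_fun h x
  have hsurj := (LinearMap.injective_iff_surjective_of_finrank_eq_finrank
    (Subspace.dual_finrank_eq (K := ℝ) (V := TangentSpace 𝓘(ℝ, E) p)).symm).1 hinj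
  have h : ∃ u : TangentSpace 𝓘(ℝ, E) p, ∀ w, g.inner p u w = φ w := by
    obtain ⟨u, hu⟩ := hsurj (IsLinearMap.mk' φ hφ)
    exact ⟨u, fun w => LinearMap.congr_fun hu w⟩
  rw [sharp, dif_pos h]
  exact h.choose_spec w

/-- The Koszul expression is tensorial in its last argument. -/
lemma koszul_tensorialAt_right {X Y : Π p : M, TangentSpace 𝓘(ℝ, E) p} {p : M}
    (hX : MDiffAt (T% X) p) (hY : MDiffAt (T% Y) p) :
    TensorialAt 𝓘(ℝ, E) E (fun Z => g.koszul X Y Z p) p where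
  smul {f Z} hf hZ := by
    have : CompleteSpace E := FiniteDimensional.complete ℝ E
    simp only [koszul, pair_smul_right, VectorField.mlieBracket_smul_right hf hZ,
      dirDeriv_mul hf (g.pair_mdifferentiableAt hX hZ),
      dirDeriv_mul hf (g.pair_mdifferentiableAt hY hZ)]
    simp [dirDeriv, pair, g.symm p (Z p)]
    ring
  add {Z Z'} hZ hZ' := by
    have : CompleteSpace E := FiniteDimensional.complete ℝ E
    simp only [koszul, pair_add_right, VectorField.mlieBracket_add_right hZ hZ',
      dirDeriv_add (g.pair_mdifferentiableAt hX hZ) (g.pair_mdifferentiableAt hX hZ'),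
      dirDeriv_add (g.pair_mdifferentiableAt hY hZ) (g.pair_mdifferentiableAt hY hZ')]
    simp [dirDeriv]
    ring

/-- The Koszul expression is tensorial in its first argument. -/
lemma koszul_tensorialAt_left {Y Z : Π p : M, TangentSpace 𝓘(ℝ, E) p} {p : M}
    (hY : MDiffAt (T% Y) p) (hZ : MDiffAt (T% Z) p) :
    TensorialAt 𝓘(ℝ, E) E (fun X => g.koszul X Y Z p) p where
  smul {f X} hf hX := by
    have : CompleteSpace E := FiniteDimensional.complete ℝ E
    simp only [koszul, pair_smul_left, VectorField.mlieBracket_smul_left hf hX,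
      dirDeriv_mul hf (g.pair_mdifferentiableAt hX hZ),
      dirDeriv_mul hf (g.pair_mdifferentiableAt hX hY)]
    simp [dirDeriv, pair]
    ring
  add {X X'} hX hX' := by
    have : CompleteSpace E := FiniteDimensional.complete ℝ E
    simp only [koszul, pair_add_left, VectorField.mlieBracket_add_left hX hX',
      dirDeriv_add (g.pair_mdifferentiableAt hX hZ) (g.pair_mdifferentiableAt hX' hZ),
      dirDeriv_add (g.pair_mdifferentiableAt hX hY) (g.pair_mdifferentiableAt hX' hY)]
    simp [dirDeriv]
    ring

lemma koszul_smul_mid {X Y Z : Π p : M, TangentSpace 𝓘(ℝ, E) p} {f : M → ℝ} {p : M}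
    (hf : MDiffAt f p)
    (hX : MDiffAt (T% X) p) (hY : MDiffAt (T% Y) p) (hZ : MDiffAt (T% Z) p) :
    g.koszul X (f • Y) Z p = f p * g.koszul X Y Z p + 2 * dirDeriv X f p * g.inner p (Y p) (Z p) := by
  have : CompleteSpace E := FiniteDimensional.complete ℝ E
  simp only [koszul, pair_smul_left, pair_smul_right, VectorField.mlieBracket_smul_left hf hY,
    VectorField.mlieBracket_smul_right hf hY,
    dirDeriv_mul hf (g.pair_mdifferentiableAt hX hY),
    dirDeriv_mul hf (g.pair_mdifferentiableAt hY hZ)]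
  simp [dirDeriv, pair, g.symm p (X p)]
  ring

lemma koszul_add_mid {X Y Y' Z : Π p : M, TangentSpace 𝓘(ℝ, E) p} {p : M}
    (hX : MDiffAt (T% X) p) (hY : MDiffAt (T% Y) p) (hY' : MDiffAt (T% Y') p)
    (hZ : MDiffAt (T% Z) p) :
    g.koszul X (Y + Y') Z p = g.koszul X Y Z p + g.koszul X Y' Z p := by
  have : CompleteSpace E := FiniteDimensional.complete ℝ E
  simp only [koszul, pair_add_left, pair_add_right, VectorField.mlieBracket_add_left hY hY',
    VectorField.mlieBracket_add_right hY hY',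
    dirDeriv_add (g.pair_mdifferentiableAt hX hY) (g.pair_mdifferentiableAt hX hY'),
    dirDeriv_add (g.pair_mdifferentiableAt hY hZ) (g.pair_mdifferentiableAt hY' hZ)]
  simp [dirDeriv]
  ring

lemma inner_nabla {X Y Z : Π p : M, TangentSpace 𝓘(ℝ, E) p} {p : M}
    (hX : MDiffAt (T% X) p) (hY : MDiffAt (T% Y) p) (hZ : MDiffAt (T% Z) p) :
    g.inner p (g.nabla Y p (X p)) (Z p) = g.koszul X Y Z p / 2 := by
  have hr {A : Π p : M, TangentSpace 𝓘(ℝ, E) p} (hA : MDiffAt (T% A) p) :=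
    g.koszul_tensorialAt_right hA hY
  rw [nabla, g.inner_sharp]
  · rw [(hr (ext_mdifferentiableAt _)).pointwise (ext_mdifferentiableAt (Z p)) hZ (by simp),
      (g.koszul_tensorialAt_left hY hZ).pointwise (ext_mdifferentiableAt (X p)) hX (by simp)]
  · have h := hr (ext_mdifferentiableAt (X p))
    constructor
    · intro v w
      have := map_add (TensorialAt.mkHom _ p h) v w
      simp only [TensorialAt.mkHom_apply_eq_extend] at this
      simp only [ext] at this ⊢
      rw [this]; ring
    · intro c v
      have := map_smul (TensorialAt.mkHom _ p h) c v
      simp only [TensorialAt.mkHom_apply_eq_extend] at this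
      simp only [ext, smul_eq_mul] at this ⊢
      rw [this]; ring

lemma nabla_add_dir {Y : Π p : M, TangentSpace 𝓘(ℝ, E) p} {p : M} (hY : MDiffAt (T% Y) p)
    (v w : TangentSpace 𝓘(ℝ, E) p) : g.nabla Y p (v + w) = g.nabla Y p v + g.nabla Y p w := by
  refine g.eq_of_inner_eq fun z => ?_
  have hv := ext_mdifferentiableAt v
  have hw := ext_mdifferentiableAt w
  have hz := ext_mdifferentiableAt z
  have h1 := g.inner_nabla hv hY hz
  have h2 := g.inner_nabla hw hY hz
  have h3 := g.inner_nabla (mdifferentiableAt_add_section hv hw) hY hz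
  rw [(g.koszul_tensorialAt_left hY hz).add hv hw] at h3
  simp only [ext_self, Pi.add_apply, map_add, add_apply] at h1 h2 h3 ⊢
  rw [h1, h2, h3]; ring

lemma nabla_smul_dir {Y : Π p : M, TangentSpace 𝓘(ℝ, E) p} {p : M} (hY : MDiffAt (T% Y) p)
    (c : ℝ) (v : TangentSpace 𝓘(ℝ, E) p) : g.nabla Y p (c • v) = c • g.nabla Y p v := by
  refine g.eq_of_inner_eq fun z => ?_
  have hv := ext_mdifferentiableAt v
  have hz := ext_mdifferentiableAt z
  have hc : MDiffAt (fun _ : M => c) p := mdifferentiableAt_const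
  have h1 := g.inner_nabla hv hY hz
  have h3 := g.inner_nabla (hc.smul_section hv) hY hz
  rw [(g.koszul_tensorialAt_left hY hz).smul hc hv] at h3
  simp only [ext_self, Pi.smul_apply', map_smul, smul_apply,
    smul_eq_mul] at h1 h3 ⊢
  rw [h1, h3]; ring

lemma nabla_add {Y Y' : Π p : M, TangentSpace 𝓘(ℝ, E) p} {p : M} (hY : MDiffAt (T% Y) p)
    (hY' : MDiffAt (T% Y') p) (v : TangentSpace 𝓘(ℝ, E) p) :
    g.nabla (Y + Y') p v = g.nabla Y p v + g.nabla Y' p v := by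
  refine g.eq_of_inner_eq fun z => ?_
  have hv := ext_mdifferentiableAt v
  have hz := ext_mdifferentiableAt z
  have h1 := g.inner_nabla hv hY hz
  have h2 := g.inner_nabla hv hY' hz
  have h3 := g.inner_nabla hv (mdifferentiableAt_add_section hY hY') hz
  rw [g.koszul_add_mid hv hY hY' hz] at h3
  simp only [ext_self, map_add, add_apply] at h1 h2 h3 ⊢
  rw [h1, h2, h3]; ring

lemma nabla_smul {Y : Π p : M, TangentSpace 𝓘(ℝ, E) p} {f : M → ℝ} {p : M} (hf : MDiffAt f p)
    (hY : MDiffAt (T% Y) p) (v : TangentSpace 𝓘(ℝ, E) p) :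
    g.nabla (f • Y) p v = mvfderiv 𝓘(ℝ, E) f p v • Y p + f p • g.nabla Y p v := by
  refine g.eq_of_inner_eq fun z => ?_
  have hv := ext_mdifferentiableAt v
  have hz := ext_mdifferentiableAt z
  have h1 := g.inner_nabla hv hY hz
  have h3 := g.inner_nabla hv (hf.smul_section hY) hz
  rw [g.koszul_smul_mid hf hv hY hz] at h3
  simp only [ext_self, map_add, map_smul, add_apply,
    smul_apply, smul_eq_mul, dirDeriv] at h1 h3 ⊢
  rw [h1, h3]; ring

/-- The Levi-Civita connection is compatible with the metric. -/
lemma mvfderiv_pair {Y Z : Π p : M, TangentSpace 𝓘(ℝ, E) p} {p : M} (hY : MDiffAt (T% Y) p)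
    (hZ : MDiffAt (T% Z) p) (v : TangentSpace 𝓘(ℝ, E) p) :
    mvfderiv 𝓘(ℝ, E) (g.pair Y Z) p v
      = g.inner p (g.nabla Y p v) (Z p) + g.inner p (Y p) (g.nabla Z p v) := by
  have hv := ext_mdifferentiableAt v
  have h1 := g.inner_nabla hv hY hZ
  have h2 := g.inner_nabla hv hZ hY
  rw [g.symm p (Y p)]
  rw [ext_self] at h1 h2
  rw [h1, h2, koszul, koszul, g.pair_comm Z Y, VectorField.mlieBracket_swap_apply (V := Z)]
  simp [dirDeriv]
  ring

/-- The Levi-Civita connection is torsion-free. -/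
lemma nabla_sub_nabla {X Y : Π p : M, TangentSpace 𝓘(ℝ, E) p} {p : M} (hX : MDiffAt (T% X) p)
    (hY : MDiffAt (T% Y) p) :
    g.nabla Y p (X p) - g.nabla X p (Y p) = VectorField.mlieBracket 𝓘(ℝ, E) X Y p := by
  refine g.eq_of_inner_eq fun z => ?_
  have hz := ext_mdifferentiableAt z
  have h1 := g.inner_nabla hX hY hz
  have h2 := g.inner_nabla hY hX hz
  rw [ext_self] at h1 h2
  rw [map_sub, sub_apply, h1, h2, koszul, koszul, g.pair_comm Y X,
    VectorField.mlieBracket_swap_apply (V := Y) (W := X)]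
  simp
  ring

end pointwise

end PseudoRiemannianMetric

/-! ### Dual frames, gradients and smoothness -/

/-- A function with vanishing differential on a connected manifold is constant. -/
lemma exists_eq_const_of_mvfderiv_eq_zero {E : Type*} [NormedAddCommGroup E] [NormedSpace ℝ E]
    {M : Type*} [TopologicalSpace M] [ChartedSpace E M] [IsManifold 𝓘(ℝ, E) ∞ M]
    [ConnectedSpace M] {f : M → ℝ} (hf : ContMDiff 𝓘(ℝ, E) 𝓘(ℝ, ℝ) ∞ f)
    (h : ∀ p, mvfderiv 𝓘(ℝ, E) f p = 0) : ∃ C, ∀ p, f p = C := by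
  suffices hl : IsLocallyConstant f by
    obtain ⟨C, hC⟩ := hl.exists_eq_const
    exact ⟨C, fun p => by simp [hC]⟩
  rw [IsLocallyConstant.iff_eventually_eq]
  intro p
  set c := extChartAt 𝓘(ℝ, E) p with hc
  have hsm : ∀ x ∈ c.target, HasFDerivAt (f ∘ c.symm) (0 : E →L[ℝ] ℝ) x := by
    intro x hx
    have h1 : MDifferentiableAt 𝓘(ℝ, E) 𝓘(ℝ, E) c.symm x :=
      ((contMDiffOn_extChartAt_symm (n := ∞) p).contMDiffAt
        ((isOpen_extChartAt_target p).mem_nhds hx)).mdifferentiableAt (by simp)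
    have h2 : MDifferentiableAt 𝓘(ℝ, E) 𝓘(ℝ, ℝ) f (c.symm x) :=
      (hf.mdifferentiable (by simp)) _
    have h3 := mvfderiv_comp x h2 h1
    rw [h] at h3
    have h4 : DifferentiableAt ℝ (f ∘ c.symm) x := (h2.comp x h1).differentiableAt
    have h5 : fderiv ℝ (f ∘ c.symm) x = 0 := by
      have : mvfderiv 𝓘(ℝ, E) (f ∘ c.symm) x = fderiv ℝ (f ∘ c.symm) x := by
        simp only [mvfderiv, mfderiv_eq_fderiv]; rfl
      rw [← this, h3]; rfl
    exact h5 ▸ h4.hasFDerivAt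
  obtain ⟨r, hr, hball⟩ := Metric.isOpen_iff.1 (isOpen_extChartAt_target (I := 𝓘(ℝ, E)) p)
    (c p) (mem_extChartAt_target p)
  filter_upwards [extChartAt_source_mem_nhds (I := 𝓘(ℝ, E)) p,
    (continuousAt_extChartAt (I := 𝓘(ℝ, E)) p).preimage_mem_nhds (Metric.ball_mem_nhds _ hr)]
    with q hq hq'
  have := (convex_ball (c p) r).is_const_of_fderivWithin_eq_zero (𝕜 := ℝ) (f := f ∘ c.symm)
    (fun x hx => (hsm x (hball hx)).differentiableAt.differentiableWithinAt)
    (fun x hx => by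
      rw [fderivWithin_of_isOpen Metric.isOpen_ball hx, (hsm x (hball hx)).fderiv])
    hq' (Metric.mem_ball_self hr)
  simpa only [Function.comp, hc, extChartAt_to_inv, (extChartAt 𝓘(ℝ, E) p).left_inv hq] using this

lemma ContMDiffAt.matrix_det {E : Type*} [NormedAddCommGroup E] [NormedSpace ℝ E]
    {M : Type*} [TopologicalSpace M] [ChartedSpace E M] {ι : Type*} [Fintype ι] [DecidableEq ι]
    {A : M → Matrix ι ι ℝ} {p : M} (h : ∀ i j, CMDiffAt ∞ (fun q => A q i j) p) :
    CMDiffAt ∞ (fun q => (A q).det) p := by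
  simp only [Matrix.det_apply']
  exact contMDiffAt_finsetSum fun σ _ =>
    contMDiffAt_const.mul (contMDiffAt_finsetProd fun i _ => h _ _)

lemma ContMDiffAt.matrix_inv {E : Type*} [NormedAddCommGroup E] [NormedSpace ℝ E]
    {M : Type*} [TopologicalSpace M] [ChartedSpace E M] {ι : Type*} [Fintype ι] [DecidableEq ι]
    {A : M → Matrix ι ι ℝ} {p : M} (h : ∀ i j, CMDiffAt ∞ (fun q => A q i j) p)
    (hp : (A p).det ≠ 0) (i j : ι) : CMDiffAt ∞ (fun q => (A q)⁻¹ i j) p := by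
  simp only [Matrix.inv_def, Ring.inverse_eq_inv', Matrix.smul_apply, smul_eq_mul,
    Matrix.adjugate_apply]
  refine ((ContMDiffAt.matrix_det h).inv₀ hp).mul (ContMDiffAt.matrix_det fun k l => ?_)
  rcases eq_or_ne k j with rfl | hk
  · simpa using contMDiffAt_const
  · simpa [Matrix.updateRow_ne hk] using h k l

namespace PseudoRiemannianMetric

section dualFamilies

variable {E : Type*} [NormedAddCommGroup E] [NormedSpace ℝ E]
  {M : Type*} [TopologicalSpace M] [ChartedSpace E M] [IsManifold 𝓘(ℝ, E) ∞ M]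
  (g : PseudoRiemannianMetric E M)

/-- Two families of `dim E` tangent vectors at `p` which are dual to each other with respect
to `g`. -/
def IsDualPair {p : M} (e e' : Fin (Module.finrank ℝ E) → TangentSpace 𝓘(ℝ, E) p) : Prop :=
  ∀ i j, g.inner p (e i) (e' j) = if i = j then 1 else 0

variable {g} {p : M} {e e' : Fin (Module.finrank ℝ E) → TangentSpace 𝓘(ℝ, E) p}

lemma IsDualPair.symm (h : g.IsDualPair e e') : g.IsDualPair e' e := fun i j => by
  rw [g.symm, h]; simp [eq_comm]

variable [FiniteDimensional ℝ E]

/-- The first family of a dual pair is a basis, whose coordinate functions are the pairings with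
the second one. -/
lemma IsDualPair.exists_basis (h : g.IsDualPair e e') :
    ∃ b : Module.Basis (Fin (Module.finrank ℝ E)) ℝ (TangentSpace 𝓘(ℝ, E) p),
      (∀ i, b i = e i) ∧ ∀ v i, b.repr v i = g.inner p v (e' i) := by
  have hli : LinearIndependent ℝ e := by
    rw [Fintype.linearIndependent_iff]
    intro c hc i
    have := congrArg (fun v => g.inner p v (e' i)) hc
    simpa [h _ _] using this
  have : FiniteDimensional ℝ (TangentSpace 𝓘(ℝ, E) p) := inferInstanceAs (FiniteDimensional ℝ E)
  let b := basisOfLinearIndependentOfCardEqFinrank' e hli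
    ((Fintype.card_fin _).trans
      (rfl : Module.finrank ℝ E = Module.finrank ℝ (TangentSpace 𝓘(ℝ, E) p)))
  have hb : ∀ i, b i = e i := fun i => by simp [b]
  refine ⟨b, hb, fun v i => ?_⟩
  conv_rhs => rw [← b.sum_repr v]
  simp [hb, h _ _]

lemma IsDualPair.sum_smul (h : g.IsDualPair e e') (v : TangentSpace 𝓘(ℝ, E) p) :
    ∑ i, g.inner p v (e' i) • e i = v := by
  obtain ⟨b, hb, hr⟩ := h.exists_basis
  simp only [← hb, ← hr, b.sum_repr]

lemma IsDualPair.trace_eq (h : g.IsDualPair e e')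
    (L : TangentSpace 𝓘(ℝ, E) p →ₗ[ℝ] TangentSpace 𝓘(ℝ, E) p) :
    LinearMap.trace ℝ _ L = ∑ i, g.inner p (L (e i)) (e' i) := by
  obtain ⟨b, hb, hr⟩ := h.exists_basis
  simp [LinearMap.trace_eq_matrix_trace ℝ b, Matrix.trace, LinearMap.toMatrix_apply, hb, hr]

lemma IsDualPair.eq_of_inner_eq (h : g.IsDualPair e e') {u v : TangentSpace 𝓘(ℝ, E) p}
    (huv : ∀ i, g.inner p u (e i) = g.inner p v (e i)) : u = v := by
  rw [← h.symm.sum_smul u, ← h.symm.sum_smul v]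
  simp only [huv]

lemma isDualPair_coframe (p : M) : g.IsDualPair (frame E p) (g.coframe p) := fun i j => by
  rw [g.symm, coframe, g.inner_sharp ⟨by simp, by simp⟩]
  simp [Finsupp.single_apply]

end dualFamilies

variable {E : Type*} [NormedAddCommGroup E] [NormedSpace ℝ E] [FiniteDimensional ℝ E]
  {M : Type*} [TopologicalSpace M] [ChartedSpace E M] [IsManifold 𝓘(ℝ, E) ∞ M]
  (g : PseudoRiemannianMetric E M)

lemma inner_cov {X Y Z : Π p : M, TangentSpace 𝓘(ℝ, E) p} {p : M} (hX : IsSmoothField X)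
    (hY : IsSmoothField Y) (hZ : IsSmoothField Z) :
    g.inner p (g.cov X Y p) (Z p) = g.koszul X Y Z p / 2 :=
  g.inner_nabla (hX.mdifferentiableAt p) (hY.mdifferentiableAt p) (hZ.mdifferentiableAt p)

lemma inner_grad (f : M → ℝ) (p : M) (w : TangentSpace 𝓘(ℝ, E) p) :
    g.inner p (g.grad f p) w = mvfderiv 𝓘(ℝ, E) f p w :=
  g.inner_sharp ⟨by simp, by simp⟩ w

variable [T2Space M]

/-- There are smooth vector fields which are dual frames near `p`: extend a basis of `T_p M` to
smooth fields `e i`; the dual fields `e' i` come from the inverse Gram matrix of the `e i`. -/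
lemma exists_dual_frame (p : M) :
    ∃ e e' : Fin (Module.finrank ℝ E) → Π q : M, TangentSpace 𝓘(ℝ, E) q,
      (∀ i, IsSmoothField (e i)) ∧ (∀ i, IsSmoothField (e' i)) ∧
      ∀ᶠ q in 𝓝 p, g.IsDualPair (fun i => e i q) (fun i => e' i q) := by
  let b := frame E p
  choose e he hep using fun i => exists_isSmoothField_apply_eq (b i)
  let G : M → Matrix (Fin (Module.finrank ℝ E)) (Fin (Module.finrank ℝ E)) ℝ :=
    fun q => Matrix.of fun i j => g.pair (e i) (e j) q
  have hG : ∀ q i j, CMDiffAt ∞ (fun q => G q i j) q := fun q i j =>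
    g.pair_contMDiff (he i) (he j) q
  have hdet : ∀ q, CMDiffAt ∞ (fun q => (G q).det) q := fun q => ContMDiffAt.matrix_det (hG q)
  have hp : (G p).det ≠ 0 := by
    intro h0
    obtain ⟨c, hc, hc0⟩ := Matrix.exists_mulVec_eq_zero_iff.2 h0
    have hz : ∑ j, c j • b j = 0 := by
      refine g.eq_of_inner_eq fun w => ?_
      rw [← b.sum_repr w, map_zero, zero_apply, map_sum]
      refine Finset.sum_eq_zero fun i _ => ?_
      have := congrFun hc0 i
      simp only [Matrix.mulVec, dotProduct, G, Matrix.of_apply, pair, hep, Pi.zero_apply] at this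
      rw [map_smul, g.symm, map_sum]
      simp only [map_smul, smul_eq_mul]
      rw [← mul_zero ((b.repr w) i), ← this]
      simp only [mul_comm (c _)]
    exact hc (funext fun i => by
      simpa using Fintype.linearIndependent_iff.1 b.linearIndependent c hz i)
  have hev : ∀ᶠ q in 𝓝 p, (G q).det ≠ 0 := (hdet p).continuousAt.eventually_ne hp
  let H : M → Fin (Module.finrank ℝ E) → Fin (Module.finrank ℝ E) → ℝ := fun q j k => (G q)⁻¹ j k
  have hex : ∀ j, ∃ Y : Π q : M, TangentSpace 𝓘(ℝ, E) q, IsSmoothField Y ∧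
      ∀ᶠ q in 𝓝 p, Y q = (∑ k, H q j k • e k q : TangentSpace 𝓘(ℝ, E) q) := fun j => by
    refine exists_isSmoothField_eventuallyEq hev fun q hq => ?_
    refine ContMDiffAt.contMDiffWithinAt (.sum_section fun k _ => ?_)
    exact (ContMDiffAt.matrix_inv (hG q) hq j k).smul_section (he k q)
  choose e' he' hee' using hex
  refine ⟨e, e', he, he', ?_⟩
  filter_upwards [hev, eventually_all.2 hee'] with q hq hq' i j
  change g.inner q (e i q) (e' j q) = _
  rw [hq', map_sum]
  simp only [map_smul, smul_eq_mul]
  have := congrFun (congrFun (Matrix.nonsing_inv_mul (G q) (isUnit_iff_ne_zero.2 hq)) j) i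
  simp only [Matrix.mul_apply, Matrix.one_apply] at this
  rw [← if_congr (eq_comm (a := j)) rfl rfl, ← this]
  exact Finset.sum_congr rfl fun k _ => by rw [g.symm]; rfl

/-- The vector field dual to a smooth `1`-form is smooth. -/
lemma isSmoothField_sharp {φ : Π p : M, TangentSpace 𝓘(ℝ, E) p → ℝ}
    (hφ : ∀ p, IsLinearMap ℝ (φ p))
    (hs : ∀ Z : Π p : M, TangentSpace 𝓘(ℝ, E) p, IsSmoothField Z → CMDiff ∞ fun p => φ p (Z p)) :
    IsSmoothField fun p => g.sharp p (φ p) := by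
  intro p
  obtain ⟨e, e', he, he', hd⟩ := g.exists_dual_frame p
  have : CMDiffAt ∞ (T% fun q => ∑ i, φ q (e i q) • e' i q) p :=
    .sum_section fun i _ => (hs _ (he i) p).smul_section (he' i p)
  refine this.congr_of_eventuallyEq ?_
  filter_upwards [hd] with q hq
  congr 1
  refine hq.eq_of_inner_eq fun i => ?_
  rw [g.inner_sharp (hφ q), map_sum, sum_apply]
  simp [hq.symm _ _]

/-- The covariant derivative of a smooth field along a smooth field is smooth. -/
lemma IsSmoothField.cov {X Y : Π p : M, TangentSpace 𝓘(ℝ, E) p} (hX : IsSmoothField X)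
    (hY : IsSmoothField Y) : IsSmoothField (g.cov X Y) := by
  have : CompleteSpace E := FiniteDimensional.complete ℝ E
  have h : g.cov X Y = fun p => g.sharp p fun w => g.inner p (g.cov X Y p) w := by
    funext p
    refine g.eq_of_inner_eq fun w => ?_
    rw [g.inner_sharp ⟨by simp, by simp⟩]
  rw [h]
  refine g.isSmoothField_sharp (fun p => ⟨by simp, by simp⟩) fun Z hZ => ?_
  have : (fun p => g.inner p (g.cov X Y p) (Z p)) = fun p => (dirDeriv X (g.pair Y Z) p
      + dirDeriv Y (g.pair X Z) p - dirDeriv Z (g.pair X Y) p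
      + g.pair (VectorField.mlieBracket 𝓘(ℝ, E) X Y) Z p
      - g.pair (VectorField.mlieBracket 𝓘(ℝ, E) X Z) Y p
      - g.pair (VectorField.mlieBracket 𝓘(ℝ, E) Y Z) X p) / 2 := by
    funext p
    rw [g.inner_cov hX hY hZ]
    rfl
  rw [this]
  exact ((((((dirDeriv_contMDiff hX (g.pair_contMDiff hY hZ)).add
    (dirDeriv_contMDiff hY (g.pair_contMDiff hX hZ))).sub
    (dirDeriv_contMDiff hZ (g.pair_contMDiff hX hY))).add
    (g.pair_contMDiff (hX.mlieBracket hY) hZ)).sub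
    (g.pair_contMDiff (hX.mlieBracket hZ) hY)).sub
    (g.pair_contMDiff (hY.mlieBracket hZ) hX)).div_const 2

lemma isSmoothField_grad {f : M → ℝ} (hf : CMDiff ∞ f) : IsSmoothField (g.grad f) :=
  g.isSmoothField_sharp (fun p => ⟨by simp, by simp⟩) fun _ hZ => dirDeriv_contMDiff hZ hf

end PseudoRiemannianMetric

/-! ### Connections on Lie rings -/

namespace LieConnection

variable {V A : Type*} [LieRing V] [AddCommGroup A] (D : V →+ V →+ V)

/-- The curvature `R(X, Y) Z = ∇_X ∇_Y Z - ∇_Y ∇_X Z - ∇_{[X, Y]} Z` of a connection `∇` on a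
Lie ring. -/
def curv (X Y Z : V) : V := D X (D Y Z) - D Y (D X Z) - D ⁅X, Y⁆ Z

lemma curv_add_left (X X' Y Z : V) : curv D (X + X') Y Z = curv D X Y Z + curv D X' Y Z := by
  simp only [curv, map_add, AddMonoidHom.add_apply, add_lie]; abel

lemma curv_add_mid (X Y Y' Z : V) : curv D X (Y + Y') Z = curv D X Y Z + curv D X Y' Z := by
  simp only [curv, map_add, AddMonoidHom.add_apply, lie_add]; abel

lemma curv_add_right (X Y Z Z' : V) : curv D X Y (Z + Z') = curv D X Y Z + curv D X Y Z' := by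
  simp only [curv, map_add]; abel

lemma curv_swap (X Y Z : V) : curv D X Y Z = -curv D Y X Z := by
  simp only [curv, ← lie_skew X Y, map_neg, AddMonoidHom.neg_apply]; abel

lemma curv_sub_left (X X' Y Z : V) : curv D (X - X') Y Z = curv D X Y Z - curv D X' Y Z := by
  rw [eq_sub_iff_add_eq, ← curv_add_left, sub_add_cancel]

/-- The covariant derivative `(∇_X R)(Y, Z) W` of the curvature. -/
def covCurv (X Y Z W : V) : V :=
  D X (curv D Y Z W) - curv D (D X Y) Z W - curv D Y (D X Z) W - curv D Y Z (D X W)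

lemma covCurv_swap (X Y Z W : V) : covCurv D X Y Z W = -covCurv D X Z Y W := by
  simp only [covCurv, curv_swap D Z Y, curv_swap D Z (D X Y), curv_swap D (D X Z) Y, map_neg]
  abel

variable {D}

/-- The second Bianchi identity. -/
theorem second_bianchi (htf : ∀ X Y, D X Y - D Y X = ⁅X, Y⁆) (X Y Z W : V) :
    covCurv D X Y Z W + covCurv D Y Z X W + covCurv D Z X Y W = 0 := by
  have h : ∀ A B C : V, curv D (D A B) C W - curv D (D B A) C W = curv D ⁅A, B⁆ C W := by
    intro A B C; rw [← curv_sub_left, htf]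
  have h1 := h X Y Z
  have h2 := h Y Z X
  have h3 := h Z X Y
  have key : covCurv D X Y Z W + covCurv D Y Z X W + covCurv D Z X Y W
      = (D X (curv D Y Z W) - curv D Y Z (D X W)) + (D Y (curv D Z X W) - curv D Z X (D Y W))
        + (D Z (curv D X Y W) - curv D X Y (D Z W))
        - (curv D ⁅X, Y⁆ Z W + curv D ⁅Y, Z⁆ X W + curv D ⁅Z, X⁆ Y W) := by
    rw [← h1, ← h2, ← h3]
    simp only [covCurv, curv_swap D Y (D X Z), curv_swap D Z (D Y X), curv_swap D X (D Z Y)]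
    abel
  have J : D ⁅⁅X, Y⁆, Z⁆ W + D ⁅⁅Y, Z⁆, X⁆ W + D ⁅⁅Z, X⁆, Y⁆ W = 0 := by
    rw [← AddMonoidHom.add_apply, ← AddMonoidHom.add_apply, ← map_add, ← map_add]
    have : ⁅⁅X, Y⁆, Z⁆ + ⁅⁅Y, Z⁆, X⁆ + ⁅⁅Z, X⁆, Y⁆ = 0 := by
      have := lie_jacobi X Y Z
      rw [← lie_skew ⁅X, Y⁆ Z, ← lie_skew ⁅Y, Z⁆ X, ← lie_skew ⁅Z, X⁆ Y, ← neg_eq_zero, ← this]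
      abel
    rw [this, map_zero, AddMonoidHom.zero_apply]
  rw [key, ← neg_eq_zero, ← neg_eq_zero, ← J]
  simp only [curv, map_sub]
  abel

section metric

variable {act : V →+ A →+ A} {ip : V →+ V →+ A}

/-- The curvature of a metric connection is skew with respect to the metric. -/
theorem ip_curv_skew (hact : ∀ X Y a, act ⁅X, Y⁆ a = act X (act Y a) - act Y (act X a))
    (hmet : ∀ X Y Z, act X (ip Y Z) = ip (D X Y) Z + ip Y (D X Z)) (X Y Z W : V) :
    ip (curv D X Y Z) W = -ip Z (curv D X Y W) := by
  have h := hact X Y (ip Z W)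
  simp only [hmet, map_add] at h
  rw [← sub_eq_zero] at h
  rw [← sub_eq_zero, ← neg_eq_zero, ← h]
  simp only [curv, map_sub, AddMonoidHom.sub_apply]
  abel

theorem ip_covCurv_skew (hact : ∀ X Y a, act ⁅X, Y⁆ a = act X (act Y a) - act Y (act X a))
    (hmet : ∀ X Y Z, act X (ip Y Z) = ip (D X Y) Z + ip Y (D X Z)) (U X Y Z W : V) :
    ip (covCurv D U X Y Z) W = -ip Z (covCurv D U X Y W) := by
  have sk := ip_curv_skew hact hmet
  have h := congrArg (act U) (sk X Y Z W)
  simp only [hmet, map_neg] at h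
  rw [← sub_eq_zero] at h
  rw [← sub_eq_zero, ← h]
  simp only [covCurv, map_sub, AddMonoidHom.sub_apply, sk (D U X) Y Z W, sk X (D U Y) Z W,
    sk X Y (D U Z) W, sk X Y Z (D U W)]
  abel

/-- The Koszul formula. -/
theorem two_ip (htf : ∀ X Y, D X Y - D Y X = ⁅X, Y⁆) (hsymm : ∀ X Y, ip X Y = ip Y X)
    (hmet : ∀ X Y Z, act X (ip Y Z) = ip (D X Y) Z + ip Y (D X Z)) (X Y Z : V) :
    ip (D X Y) Z + ip (D X Y) Z = act X (ip Y Z) + act Y (ip X Z) - act Z (ip X Y)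
      + ip ⁅X, Y⁆ Z - ip ⁅X, Z⁆ Y - ip ⁅Y, Z⁆ X := by
  simp only [hmet, ← htf, map_sub, AddMonoidHom.sub_apply]
  rw [hsymm (D Z X) Y, hsymm (D X Z) Y, hsymm (D Y Z) X, hsymm (D Z Y) X]
  abel

/-- A Killing field preserves the Levi-Civita connection: apply it to the Koszul formula. -/
theorem lie_conn (hact : ∀ X Y a, act ⁅X, Y⁆ a = act X (act Y a) - act Y (act X a))
    (htf : ∀ X Y, D X Y - D Y X = ⁅X, Y⁆) (hsymm : ∀ X Y, ip X Y = ip Y X)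
    (hmet : ∀ X Y Z, act X (ip Y Z) = ip (D X Y) Z + ip Y (D X Z))
    (htwo : ∀ a : A, a + a = 0 → a = 0) (hnd : ∀ X, (∀ Y, ip X Y = 0) → X = 0)
    {K : V} (hK : ∀ Y Z, act K (ip Y Z) = ip ⁅K, Y⁆ Z + ip Y ⁅K, Z⁆) (Y Z : V) :
    ⁅K, D Y Z⁆ = D ⁅K, Y⁆ Z + D Y ⁅K, Z⁆ := by
  rw [← sub_eq_zero]
  refine hnd _ fun W => htwo _ ?_
  have T := two_ip (act := act) htf hsymm hmet
  have h := congrArg (act K) (T Y Z W)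
  have hc : ∀ X a, act K (act X a) = act ⁅K, X⁆ a + act X (act K a) := by
    intro X a; rw [hact]; abel
  simp only [map_add, map_sub, hc, hK] at h
  have h1 := T ⁅K, Y⁆ Z W
  have h2 := T Y ⁅K, Z⁆ W
  have h3 := T Y Z ⁅K, W⁆
  simp only [leibniz_lie K, map_add, AddMonoidHom.add_apply] at h h1 h2 h3
  rw [← sub_eq_zero] at h h1 h2 h3
  have e : (0 : A) = 0 - 0 - 0 - 0 := by simp
  simp only [map_add, map_sub, AddMonoidHom.add_apply, AddMonoidHom.sub_apply]
  rw [e]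
  nth_rewrite 1 [← h]
  nth_rewrite 1 [← h1]
  nth_rewrite 1 [← h2]
  nth_rewrite 1 [← h3]
  abel

/-- A derivation of the bracket which preserves the connection preserves the curvature. -/
theorem lie_curv {K : V} (h : ∀ Y Z, ⁅K, D Y Z⁆ = D ⁅K, Y⁆ Z + D Y ⁅K, Z⁆) (X Y Z : V) :
    ⁅K, curv D X Y Z⁆ = curv D ⁅K, X⁆ Y Z + curv D X ⁅K, Y⁆ Z + curv D X Y ⁅K, Z⁆ := by
  simp only [curv, lie_sub, h, map_add, leibniz_lie K, AddMonoidHom.add_apply]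
  abel

end metric

end LieConnection

/-! ### Smooth vector fields as a Lie ring -/

namespace PseudoRiemannianMetric

section bundled

variable (E : Type*) [NormedAddCommGroup E] [NormedSpace ℝ E]
  (M : Type*) [TopologicalSpace M] [ChartedSpace E M]

/-- The algebra `C^∞(M)`. -/
def smoothFunctions : Subalgebra ℝ (M → ℝ) where
  carrier := {f | CMDiff ∞ f}
  mul_mem' hf hg := ContMDiff.mul hf hg
  add_mem' hf hg := ContMDiff.add hf hg
  algebraMap_mem' _ := contMDiff_const

variable [IsManifold 𝓘(ℝ, E) ∞ M]

/-- The `C^∞(M)`-module of smooth vector fields. -/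
def smoothFields : Submodule (smoothFunctions E M) (Π p : M, TangentSpace 𝓘(ℝ, E) p) where
  carrier := {X | IsSmoothField X}
  add_mem' hX hY := ContMDiff.add_section hX hY
  zero_mem' := contMDiff_zeroSection ℝ (TangentSpace 𝓘(ℝ, E))
  smul_mem' f _ hX := ContMDiff.smul_section f.2 hX

/-- The smooth functions on `M`, as a type of its own. -/
def SmoothFunction : Type _ := smoothFunctions E M

/-- The smooth vector fields on `M`, as a type of its own. -/
def SmoothField : Type _ := smoothFields E M

noncomputable instance : CommRing (SmoothFunction E M) :=
  inferInstanceAs (CommRing (smoothFunctions E M))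

noncomputable instance : AddCommGroup (SmoothField E M) :=
  inferInstanceAs (AddCommGroup (smoothFields E M))

noncomputable instance : Module (SmoothFunction E M) (SmoothField E M) :=
  inferInstanceAs (Module (smoothFunctions E M) (smoothFields E M))

end bundled

section basic

variable {E : Type*} [NormedAddCommGroup E] [NormedSpace ℝ E]
  {M : Type*} [TopologicalSpace M] [ChartedSpace E M]

@[ext] lemma SmoothFunction.ext {f h : SmoothFunction E M} (H : ∀ p, f.1 p = h.1 p) : f = h :=
  Subtype.ext (funext H)

lemma SmoothFunction.mdifferentiableAt (f : SmoothFunction E M) (p : M) : MDiffAt f.1 p :=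
  (ContMDiff.mdifferentiable f.2 (by simp)) p

variable [IsManifold 𝓘(ℝ, E) ∞ M]

@[ext] lemma SmoothField.ext {X Y : SmoothField E M} (H : ∀ p, X.1 p = Y.1 p) : X = Y :=
  Subtype.ext (funext H)

lemma SmoothField.mdifferentiableAt (X : SmoothField E M) (p : M) : MDiffAt (T% X.1) p :=
  IsSmoothField.mdifferentiableAt X.2 p

/-- The action of vector fields on functions by derivations. -/
noncomputable def act : SmoothField E M →+ SmoothFunction E M →+ SmoothFunction E M :=
  AddMonoidHom.mk' (fun X => AddMonoidHom.mk'
      (fun f => ⟨dirDeriv X.1 f.1, dirDeriv_contMDiff X.2 f.2⟩)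
      fun f f' => by
        ext p
        exact dirDeriv_add (f.mdifferentiableAt p) (f'.mdifferentiableAt p))
    fun X X' => by
      ext f p
      exact map_add (mvfderiv 𝓘(ℝ, E) f.1 p) (X.1 p) (X'.1 p)

variable (g : PseudoRiemannianMetric E M)

/-- The metric as a pairing of smooth vector fields. -/
noncomputable def ip : SmoothField E M →+ SmoothField E M →+ SmoothFunction E M :=
  AddMonoidHom.mk' (fun X => AddMonoidHom.mk'
      (fun Y => ⟨g.pair X.1 Y.1, g.pair_contMDiff X.2 Y.2⟩)
      fun Y Y' => by
        ext p
        exact map_add _ _ _)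
    fun X X' => by
      ext Y p
      change g.inner p (X.1 p + X'.1 p) (Y.1 p) = _
      rw [map_add]
      rfl

lemma coe_ip (X Y : SmoothField E M) (p : M) : (g.ip X Y).1 p = g.inner p (X.1 p) (Y.1 p) := rfl

lemma ip_comm (X Y : SmoothField E M) : g.ip X Y = g.ip Y X := by
  ext p
  exact g.symm p _ _

end basic

variable {E : Type*} [NormedAddCommGroup E] [NormedSpace ℝ E] [FiniteDimensional ℝ E]
  {M : Type*} [TopologicalSpace M] [ChartedSpace E M] [IsManifold 𝓘(ℝ, E) ∞ M]

noncomputable instance : Bracket (SmoothField E M) (SmoothField E M) where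
  bracket X Y := ⟨VectorField.mlieBracket 𝓘(ℝ, E) X.1 Y.1,
    have := FiniteDimensional.complete ℝ E
    IsSmoothField.mlieBracket X.2 Y.2⟩

lemma coe_lie (X Y : SmoothField E M) :
    (⁅X, Y⁆ : SmoothField E M).1 = VectorField.mlieBracket 𝓘(ℝ, E) X.1 Y.1 := rfl

noncomputable instance : LieRing (SmoothField E M) where
  add_lie X Y Z := by
    have := FiniteDimensional.complete ℝ E
    ext p
    exact VectorField.mlieBracket_add_left (X.mdifferentiableAt p) (Y.mdifferentiableAt p)
  lie_add X Y Z := by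
    have := FiniteDimensional.complete ℝ E
    ext p
    exact VectorField.mlieBracket_add_right (Y.mdifferentiableAt p) (Z.mdifferentiableAt p)
  lie_self X := by
    ext p
    simp only [coe_lie, VectorField.mlieBracket_self]
    rfl
  leibniz_lie X Y Z := by
    have := FiniteDimensional.complete ℝ E
    have h2 (B : SmoothField E M) : CMDiff (minSmoothness ℝ 2) (T% B.1) := by
      simp only [minSmoothness_of_isRCLikeNormedField]
      exact ContMDiff.of_le B.2 ENat.LEInfty.out
    have h3 : IsManifold 𝓘(ℝ, E) (minSmoothness ℝ 3) M := by
      simp only [minSmoothness_of_isRCLikeNormedField]; infer_instance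
    ext p
    exact congrFun (VectorField.leibniz_identity_mlieBracket (h2 X) (h2 Y) (h2 Z)) p

lemma lie_smul_fields (f : SmoothFunction E M) (X Y : SmoothField E M) :
    ⁅X, f • Y⁆ = act X f • Y + f • ⁅X, Y⁆ := by
  have := FiniteDimensional.complete ℝ E
  ext p
  exact VectorField.mlieBracket_smul_right (f.mdifferentiableAt p) (Y.mdifferentiableAt p)

lemma smul_lie_fields (f : SmoothFunction E M) (X Y : SmoothField E M) :
    ⁅f • X, Y⁆ = -(act Y f • X) + f • ⁅X, Y⁆ := by
  rw [← lie_skew, lie_smul_fields, ← lie_skew X Y]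
  module

variable (g : PseudoRiemannianMetric E M)

variable [T2Space M]

lemma exists_smoothField_apply_eq {p : M} (v : TangentSpace 𝓘(ℝ, E) p) :
    ∃ X : SmoothField E M, X.1 p = v := by
  obtain ⟨X, hX, h⟩ := exists_isSmoothField_apply_eq v
  exact ⟨⟨X, hX⟩, h⟩

/-- The Levi-Civita connection on smooth vector fields. -/
noncomputable def conn : SmoothField E M →+ SmoothField E M →+ SmoothField E M :=
  AddMonoidHom.mk' (fun X => AddMonoidHom.mk'
      (fun Y => ⟨g.cov X.1 Y.1, IsSmoothField.cov g X.2 Y.2⟩)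
      fun Y Y' => by
        ext p
        exact g.nabla_add (Y.mdifferentiableAt p) (Y'.mdifferentiableAt p) _)
    fun X X' => by
      ext Y p
      exact g.nabla_add_dir (Y.mdifferentiableAt p) _ _

lemma coe_conn (X Y : SmoothField E M) : (g.conn X Y).1 = g.cov X.1 Y.1 := rfl

lemma act_lie (X Y : SmoothField E M) (f : SmoothFunction E M) :
    act ⁅X, Y⁆ f = act X (act Y f) - act Y (act X f) := by
  ext p
  exact dirDeriv_mlieBracket X.2 Y.2 f.2 p

lemma conn_sub_conn (X Y : SmoothField E M) : g.conn X Y - g.conn Y X = ⁅X, Y⁆ := by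
  ext p
  exact g.nabla_sub_nabla (X.mdifferentiableAt p) (Y.mdifferentiableAt p)

lemma act_ip (X Y Z : SmoothField E M) :
    act X (g.ip Y Z) = g.ip (g.conn X Y) Z + g.ip Y (g.conn X Z) := by
  ext p
  exact g.mvfderiv_pair (Y.mdifferentiableAt p) (Z.mdifferentiableAt p) _

lemma eq_zero_of_ip {X : SmoothField E M} (h : ∀ Y, g.ip X Y = 0) : X = 0 := by
  ext p
  refine g.nondegenerate p _ fun w => ?_
  obtain ⟨Y, rfl⟩ := exists_smoothField_apply_eq w
  exact congrFun (congrArg Subtype.val (h Y)) p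

lemma conn_smul_left (f : SmoothFunction E M) (X Y : SmoothField E M) :
    g.conn (f • X) Y = f • g.conn X Y := by
  ext p
  exact g.nabla_smul_dir (Y.mdifferentiableAt p) _ _

lemma conn_smul_right (f : SmoothFunction E M) (X Y : SmoothField E M) :
    g.conn X (f • Y) = act X f • Y + f • g.conn X Y := by
  ext p
  exact g.nabla_smul (f.mdifferentiableAt p) (Y.mdifferentiableAt p) _

open LieConnection

lemma curv_smul_left (f : SmoothFunction E M) (X Y Z : SmoothField E M) :
    curv g.conn (f • X) Y Z = f • curv g.conn X Y Z := by
  simp only [curv, conn_smul_left, conn_smul_right, smul_lie_fields, map_add, map_neg,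
    AddMonoidHom.add_apply, AddMonoidHom.neg_apply]
  module

lemma curv_smul_mid (f : SmoothFunction E M) (X Y Z : SmoothField E M) :
    curv g.conn X (f • Y) Z = f • curv g.conn X Y Z := by
  rw [curv_swap, curv_smul_left, curv_swap _ X]
  module

lemma curv_smul_right (f : SmoothFunction E M) (X Y Z : SmoothField E M) :
    curv g.conn X Y (f • Z) = f • curv g.conn X Y Z := by
  simp only [curv, conn_smul_right, map_add, act_lie]
  module

end PseudoRiemannianMetric

/-! ### Tensoriality of the curvature and contractions -/

namespace PseudoRiemannianMetric
open LieConnection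

variable {E : Type*} [NormedAddCommGroup E] [NormedSpace ℝ E]
  {M : Type*} [TopologicalSpace M] [ChartedSpace E M]

lemma dirDeriv_sum {ι : Type*} (s : Finset ι) (X : Π p : M, TangentSpace 𝓘(ℝ, E) p)
    (f : ι → SmoothFunction E M) (p : M) :
    dirDeriv X (fun q => ∑ i ∈ s, (f i).1 q) p = ∑ i ∈ s, dirDeriv X (f i).1 p := by
  classical
  have hs : ∀ s : Finset ι, (∑ i ∈ s, f i).1 = fun q => ∑ i ∈ s, (f i).1 q := by
    intro s
    induction s using Finset.induction_on with
    | empty => simp; rfl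
    | insert a s ha ih =>
      rw [Finset.sum_insert ha]
      funext q
      rw [Finset.sum_insert ha]
      exact congrArg ((f a).1 q + ·) (congrFun ih q)
  induction s using Finset.induction_on with
  | empty => simp [dirDeriv, mvfderiv_const]
  | insert a s ha ih =>
    rw [Finset.sum_insert ha, ← ih, ← hs s,
      ← dirDeriv_add ((f a).mdifferentiableAt p) ((∑ i ∈ s, f i).mdifferentiableAt p), hs s]
    congr 1
    funext q
    simp [Finset.sum_insert ha]

variable [IsManifold 𝓘(ℝ, E) ∞ M]

/-- Evaluation of smooth vector fields at `p`. -/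
noncomputable def SmoothField.eval (p : M) : SmoothField E M →+ TangentSpace 𝓘(ℝ, E) p :=
  AddMonoidHom.mk' (fun X => X.1 p) fun _ _ => rfl

lemma SmoothField.eval_smul (p : M) (f : SmoothFunction E M) (X : SmoothField E M) :
    SmoothField.eval p (f • X) = f.1 p • SmoothField.eval p X := rfl

variable [FiniteDimensional ℝ E] (g : PseudoRiemannianMetric E M)

/-- Let `Δ` be a derivation of vector fields along `X` which is compatible with the metric, such
as `∇_X`, or the bracket with `X` if `X` is a Killing field. Then `X (tr L) = tr (Δ L)` for every
field `L` of endomorphisms. -/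
lemma dirDeriv_trace {X : SmoothField E M} {Δ : SmoothField E M →+ SmoothField E M}
    (hΔ : ∀ Y Z, act X (g.ip Y Z) = g.ip (Δ Y) Z + g.ip Y (Δ Z))
    {L : SmoothField E M → SmoothField E M}
    {Lp : Π q : M, TangentSpace 𝓘(ℝ, E) q →ₗ[ℝ] TangentSpace 𝓘(ℝ, E) q}
    (hL : ∀ Y q, (L Y).1 q = Lp q (Y.1 q)) {p : M}
    {e e' : Fin (Module.finrank ℝ E) → SmoothField E M}
    (hd : ∀ᶠ q in 𝓝 p, g.IsDualPair (fun i => (e i).1 q) (fun i => (e' i).1 q)) :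
    dirDeriv X.1 (fun q => LinearMap.trace ℝ _ (Lp q)) p
      = ∑ i, (g.ip (Δ (L (e i)) - L (Δ (e i))) (e' i)).1 p := by
  have hdp := hd.self_of_nhds
  have h1 : dirDeriv X.1 (fun q => LinearMap.trace ℝ _ (Lp q)) p
      = ∑ i, dirDeriv X.1 (g.ip (L (e i)) (e' i)).1 p := by
    rw [← dirDeriv_sum]
    refine dirDeriv_congr rfl ?_
    filter_upwards [hd] with q hq
    rw [hq.trace_eq]
    exact Finset.sum_congr rfl fun i _ => by rw [coe_ip, hL]
  have h2 : ∀ Y Z, dirDeriv X.1 (g.ip Y Z).1 p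
      = g.inner p ((Δ Y).1 p) (Z.1 p) + g.inner p (Y.1 p) ((Δ Z).1 p) := fun Y Z =>
    congrFun (congrArg Subtype.val (hΔ Y Z)) p
  -- differentiate `g(e i, e' j) = δ_ij`
  have h3 : ∀ i j, g.inner p ((e i).1 p) ((Δ (e' j)).1 p)
      = -g.inner p ((Δ (e i)).1 p) ((e' j).1 p) := by
    intro i j
    have h4 : dirDeriv X.1 (g.ip (e i) (e' j)).1 p = 0 := by
      rw [dirDeriv_congr (X' := X.1) (f' := fun _ => if i = j then 1 else 0) rfl]
      · simp [dirDeriv, mvfderiv_const]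
      · filter_upwards [hd] with q hq
        exact hq i j
    rw [h2] at h4
    linarith
  have h5 : ∑ i, g.inner p ((L (e i)).1 p) ((Δ (e' i)).1 p)
      = -∑ i, g.inner p ((L (Δ (e i))).1 p) ((e' i).1 p) := by
    have h6 : ∀ i, g.inner p ((L (e i)).1 p) ((Δ (e' i)).1 p)
        = ∑ j, -(g.inner p ((Δ (e j)).1 p) ((e' i).1 p)
          * g.inner p ((L (e i)).1 p) ((e' j).1 p)) := by
      intro i
      conv_lhs => rw [← hdp.symm.sum_smul ((Δ (e' i)).1 p), map_sum]
      refine Finset.sum_congr rfl fun j _ => ?_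
      rw [map_smul, g.symm p ((Δ (e' i)).1 p), h3, smul_eq_mul, neg_mul]
    have h7 : ∀ i, g.inner p ((L (Δ (e i))).1 p) ((e' i).1 p)
        = ∑ j, g.inner p ((Δ (e i)).1 p) ((e' j).1 p)
          * g.inner p ((L (e j)).1 p) ((e' i).1 p) := by
      intro i
      rw [hL, ← hdp.sum_smul ((Δ (e i)).1 p), map_sum, map_sum, sum_apply]
      refine Finset.sum_congr rfl fun j _ => ?_
      rw [map_smul, map_smul, smul_apply, smul_eq_mul, ← hL, hdp.sum_smul]
    simp only [h6, h7]
    rw [Finset.sum_comm, ← Finset.sum_neg_distrib]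
    exact Finset.sum_congr rfl fun i _ => by rw [Finset.sum_neg_distrib]
  rw [h1]
  simp only [h2, Finset.sum_add_distrib, h5]
  rw [← sub_eq_add_neg, ← Finset.sum_sub_distrib]
  refine Finset.sum_congr rfl fun i _ => ?_
  rw [map_sub]
  rfl

variable [T2Space M]

lemma exists_smooth_dual_frame (p : M) :
    ∃ e e' : Fin (Module.finrank ℝ E) → SmoothField E M,
      ∀ᶠ q in 𝓝 p, g.IsDualPair (fun i => (e i).1 q) (fun i => (e' i).1 q) := by
  obtain ⟨e, e', he, he', hd⟩ := g.exists_dual_frame p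
  exact ⟨fun i => ⟨e i, he i⟩, fun i => ⟨e' i, he' i⟩, hd⟩

include g in
/-- An operation on smooth vector fields which is linear over smooth functions, up to evaluation
at `p`, depends only on the value of the field at `p`: a cutoff of the field is a combination of
a local frame whose coefficients vanish at `p`. -/
lemma eq_zero_of_apply_eq_zero {W : Type*} [AddCommGroup W] [Module ℝ W] {p : M}
    (T : SmoothField E M →+ W) (hT : ∀ (f : SmoothFunction E M) X, T (f • X) = f.1 p • T X)
    {X : SmoothField E M} (hX : X.1 p = 0) : T X = 0 := by
  obtain ⟨e, e', hd⟩ := g.exists_smooth_dual_frame p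
  obtain ⟨φ, -, hφ⟩ := (SmoothBumpFunction.nhds_basis_tsupport (I := 𝓘(ℝ, E)) p).mem_iff.1 hd
  let χ : SmoothFunction E M := ⟨φ, φ.contMDiff⟩
  have h : χ • X = ∑ i, (χ * g.ip X (e' i)) • e i := by
    ext q
    have : (∑ i, (χ * g.ip X (e' i)) • e i).1 q
        = ∑ i, (φ q * g.inner q (X.1 q) ((e' i).1 q)) • (e i).1 q :=
      map_sum (SmoothField.eval q) _ _
    rw [this]
    change φ q • X.1 q = _
    by_cases hq : φ q = 0
    · simp [hq]
    · have hq' : g.IsDualPair (fun i => (e i).1 q) (fun i => (e' i).1 q) :=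
        hφ (subset_tsupport _ hq)
      conv_lhs => rw [← hq'.sum_smul (X.1 q)]
      simp only [Finset.smul_sum, smul_smul]
  have h1 : T (χ • X) = T X := by
    rw [hT]
    change φ p • T X = T X
    simp
  rw [← h1, h, map_sum]
  refine Finset.sum_eq_zero fun i _ => ?_
  rw [hT]
  change (φ p * g.inner p (X.1 p) ((e' i).1 p)) • T (e i) = 0
  simp [hX]

include g in
lemma eq_of_apply_eq {W : Type*} [AddCommGroup W] [Module ℝ W] {p : M}
    (T : SmoothField E M →+ W) (hT : ∀ (f : SmoothFunction E M) X, T (f • X) = f.1 p • T X)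
    {X X' : SmoothField E M} (hX : X.1 p = X'.1 p) : T X = T X' := by
  rw [← sub_eq_zero, ← map_sub]
  exact g.eq_zero_of_apply_eq_zero T hT (sub_eq_zero.2 hX)

/-- The curvature of smooth vector fields is a tensor. -/
lemma curv_apply_congr {X Y Z X' Y' Z' : SmoothField E M} {p : M} (hX : X.1 p = X'.1 p)
    (hY : Y.1 p = Y'.1 p) (hZ : Z.1 p = Z'.1 p) :
    (curv g.conn X Y Z).1 p = (curv g.conn X' Y' Z').1 p := by
  let T₁ : SmoothField E M →+ TangentSpace 𝓘(ℝ, E) p := AddMonoidHom.mk'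
    (fun X => SmoothField.eval p (curv g.conn X Y Z)) fun A B => by rw [curv_add_left, map_add]
  let T₂ : SmoothField E M →+ TangentSpace 𝓘(ℝ, E) p := AddMonoidHom.mk'
    (fun Y => SmoothField.eval p (curv g.conn X' Y Z)) fun A B => by rw [curv_add_mid, map_add]
  let T₃ : SmoothField E M →+ TangentSpace 𝓘(ℝ, E) p := AddMonoidHom.mk'
    (fun Z => SmoothField.eval p (curv g.conn X' Y' Z)) fun A B => by rw [curv_add_right, map_add]
  have h₁ : T₁ X = T₁ X' := g.eq_of_apply_eq T₁ (fun f A => by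
    change SmoothField.eval p (curv g.conn (f • A) Y Z)
      = f.1 p • SmoothField.eval p (curv g.conn A Y Z)
    rw [curv_smul_left, SmoothField.eval_smul]) hX
  have h₂ : T₂ Y = T₂ Y' := g.eq_of_apply_eq T₂ (fun f A => by
    change SmoothField.eval p (curv g.conn X' (f • A) Z)
      = f.1 p • SmoothField.eval p (curv g.conn X' A Z)
    rw [curv_smul_mid, SmoothField.eval_smul]) hY
  have h₃ : T₃ Z = T₃ Z' := g.eq_of_apply_eq T₃ (fun f A => by
    change SmoothField.eval p (curv g.conn X' Y' (f • A))
      = f.1 p • SmoothField.eval p (curv g.conn X' Y' A)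
    rw [curv_smul_right, SmoothField.eval_smul]) hZ
  exact h₁.trans (h₂.trans h₃)

lemma curvatureAt_apply (X Y Z : SmoothField E M) (p : M) :
    g.curvatureAt p (X.1 p) (Y.1 p) (Z.1 p) = (curv g.conn X Y Z).1 p := by
  obtain ⟨U, hU, hU'⟩ := exists_isSmoothField_ext (X.1 p)
  obtain ⟨V, hV, hV'⟩ := exists_isSmoothField_ext (Y.1 p)
  obtain ⟨W, hW, hW'⟩ := exists_isSmoothField_ext (Z.1 p)
  have hc {A B A' B' : Π p : M, TangentSpace 𝓘(ℝ, E) p} (hA : ∀ᶠ q in 𝓝 p, A q = A' q)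
      (hB : ∀ᶠ q in 𝓝 p, B q = B' q) : ∀ᶠ q in 𝓝 p, g.cov A B q = g.cov A' B' q := by
    filter_upwards [hA, hB.eventually_nhds] with q h1 h2
    rw [cov, cov, h1, g.nabla_congr h2]
  have h : g.curvatureAt p (X.1 p) (Y.1 p) (Z.1 p) = g.curvature U V W p := by
    rw [curvatureAt, curvature, curvature, ← (hc hU' (hc hV' hW')).self_of_nhds,
      ← (hc hV' (hc hU' hW')).self_of_nhds, hU'.mlieBracket_vectorField_eq hV',
      g.nabla_congr hW']
  rw [h]
  refine g.curv_apply_congr (X := ⟨U, hU⟩) (Y := ⟨V, hV⟩) (Z := ⟨W, hW⟩) ?_ ?_ ?_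
  · exact hU'.eq_of_nhds.trans (ext_self _)
  · exact hV'.eq_of_nhds.trans (ext_self _)
  · exact hW'.eq_of_nhds.trans (ext_self _)

/-- The endomorphism `u ↦ R(u, v) w` of `T_p M`. -/
noncomputable def curvatureEnd (p : M) (v w : TangentSpace 𝓘(ℝ, E) p) :
    TangentSpace 𝓘(ℝ, E) p →ₗ[ℝ] TangentSpace 𝓘(ℝ, E) p where
  toFun u := g.curvatureAt p u v w
  map_add' u u' := by
    obtain ⟨U, rfl⟩ := exists_smoothField_apply_eq u
    obtain ⟨U', rfl⟩ := exists_smoothField_apply_eq u'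
    obtain ⟨V, rfl⟩ := exists_smoothField_apply_eq v
    obtain ⟨W, rfl⟩ := exists_smoothField_apply_eq w
    change g.curvatureAt p ((U + U').1 p) _ _ = _
    simp only [curvatureAt_apply, curv_add_left]
    rfl
  map_smul' c u := by
    obtain ⟨U, rfl⟩ := exists_smoothField_apply_eq u
    obtain ⟨V, rfl⟩ := exists_smoothField_apply_eq v
    obtain ⟨W, rfl⟩ := exists_smoothField_apply_eq w
    let f : SmoothFunction E M := ⟨fun _ => c, contMDiff_const⟩
    change g.curvatureAt p ((f • U).1 p) _ _ = _
    simp only [curvatureAt_apply, curv_smul_left]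
    rfl

lemma ricci_eq_trace (p : M) (v w : TangentSpace 𝓘(ℝ, E) p) :
    g.ricci p v w = LinearMap.trace ℝ _ (g.curvatureEnd p v w) := by
  simp [LinearMap.trace_eq_matrix_trace ℝ (frame E p), Matrix.trace, LinearMap.toMatrix_apply,
    ricci, curvatureEnd]

/-- The Ricci tensor as a contraction with a dual pair of fields. -/
lemma ricci_eq_sum {p : M} {e e' : Fin (Module.finrank ℝ E) → SmoothField E M}
    (hd : g.IsDualPair (fun i => (e i).1 p) (fun i => (e' i).1 p)) (Y Z : SmoothField E M) :
    g.ricci p (Y.1 p) (Z.1 p) = ∑ i, (g.ip (curv g.conn (e i) Y Z) (e' i)).1 p := by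
  rw [ricci_eq_trace, hd.trace_eq]
  exact Finset.sum_congr rfl fun i _ => by
    rw [coe_ip, ← curvatureAt_apply]; rfl

end PseudoRiemannianMetric

/-! ### The Ricci tensor, Killing fields and the Hessian -/

namespace PseudoRiemannianMetric
open LieConnection

variable {E : Type*} [NormedAddCommGroup E] [NormedSpace ℝ E] [FiniteDimensional ℝ E]
  {M : Type*} [TopologicalSpace M] [ChartedSpace E M] [IsManifold 𝓘(ℝ, E) ∞ M] [T2Space M]
  (g : PseudoRiemannianMetric E M)

/-- The covariant derivative of the Ricci tensor as a contraction of `∇R`. -/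
lemma covRicci_eq_sum {p : M} {e e' : Fin (Module.finrank ℝ E) → SmoothField E M}
    (hd : ∀ᶠ q in 𝓝 p, g.IsDualPair (fun i => (e i).1 q) (fun i => (e' i).1 q))
    (X Y Z : SmoothField E M) :
    g.covRicci X.1 Y.1 Z.1 p = ∑ i, (g.ip (covCurv g.conn X (e i) Y Z) (e' i)).1 p := by
  have h := g.dirDeriv_trace (X := X) (Δ := g.conn X) (L := fun U => curv g.conn U Y Z)
    (Lp := fun q => g.curvatureEnd q (Y.1 q) (Z.1 q)) (g.act_ip X)
    (fun U q => (g.curvatureAt_apply U Y Z q).symm) hd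
  have h1 := g.ricci_eq_sum hd.self_of_nhds (g.conn X Y) Z
  have h2 := g.ricci_eq_sum hd.self_of_nhds Y (g.conn X Z)
  simp only [← ricci_eq_trace] at h
  rw [coe_conn] at h1 h2
  rw [covRicci, h, h1, h2, ← Finset.sum_sub_distrib, ← Finset.sum_sub_distrib]
  refine Finset.sum_congr rfl fun i _ => ?_
  rw [covCurv, map_sub, map_sub, map_sub, map_sub]
  simp only [AddMonoidHom.sub_apply]
  change _ = (_ - _ - _ - _ : ℝ)
  rfl

/-- The contracted second Bianchi identity: twice the divergence of the Ricci tensor is the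
contraction of its covariant derivative. -/
lemma contracted_bianchi {p : M} {e e' : Fin (Module.finrank ℝ E) → SmoothField E M}
    (hd : ∀ᶠ q in 𝓝 p, g.IsDualPair (fun i => (e i).1 q) (fun i => (e' i).1 q))
    (Y : SmoothField E M) :
    2 * ∑ j, g.covRicci (e j).1 Y.1 (e' j).1 p = ∑ i, g.covRicci Y.1 (e i).1 (e' i).1 p := by
  -- the second Bianchi identity for `e j`, `Y`, `e i`, applied to `e' i` and paired with `e' j`
  have key : ∀ i j, (g.ip (covCurv g.conn (e j) (e i) Y (e' j)) (e' i)).1 p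
      - (g.ip (covCurv g.conn Y (e j) (e i) (e' i)) (e' j)).1 p
      + (g.ip (covCurv g.conn (e i) (e j) Y (e' i)) (e' j)).1 p = 0 := by
    intro i j
    have hB := second_bianchi (D := g.conn) g.conn_sub_conn (e j) Y (e i) (e' i)
    have hB' := congrArg (fun U : SmoothField E M => (g.ip U (e' j)).1 p) hB
    have h1 : g.ip (covCurv g.conn (e j) Y (e i) (e' i)) (e' j)
        = g.ip (covCurv g.conn (e j) (e i) Y (e' j)) (e' i) := by
      rw [ip_covCurv_skew (D := g.conn) (act := act) (ip := g.ip) act_lie g.act_ip,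
        covCurv_swap g.conn (e j) Y, map_neg, neg_neg, g.ip_comm]
    have h2 : g.ip (covCurv g.conn Y (e i) (e j) (e' i)) (e' j)
        = -g.ip (covCurv g.conn Y (e j) (e i) (e' i)) (e' j) := by
      rw [covCurv_swap g.conn Y (e i), map_neg, AddMonoidHom.neg_apply]
    have h3 : (g.ip (covCurv g.conn (e j) Y (e i) (e' i)) (e' j)).1 p
        + (g.ip (covCurv g.conn Y (e i) (e j) (e' i)) (e' j)).1 p
        + (g.ip (covCurv g.conn (e i) (e j) Y (e' i)) (e' j)).1 p = 0 := by
      refine Eq.trans ?_ (hB'.trans ?_)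
      · rw [map_add, map_add]
        rfl
      · rw [map_zero]
        rfl
    rw [h1, h2] at h3
    exact h3
  have hs : ∑ i, ∑ j, ((g.ip (covCurv g.conn (e j) (e i) Y (e' j)) (e' i)).1 p
      - (g.ip (covCurv g.conn Y (e j) (e i) (e' i)) (e' j)).1 p
      + (g.ip (covCurv g.conn (e i) (e j) Y (e' i)) (e' j)).1 p) = 0 :=
    Finset.sum_eq_zero fun i _ => Finset.sum_eq_zero fun j _ => key i j
  simp only [Finset.sum_add_distrib, Finset.sum_sub_distrib] at hs
  rw [Finset.sum_comm] at hs
  simp only [← g.covRicci_eq_sum hd] at hs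
  linarith

section killing

variable {X : SmoothField E M}

/-- A Killing field preserves the Levi-Civita connection. -/
lemma lie_conn_of_killing (hX : ∀ Y Z, act X (g.ip Y Z) = g.ip ⁅X, Y⁆ Z + g.ip Y ⁅X, Z⁆)
    (Y Z : SmoothField E M) : ⁅X, g.conn Y Z⁆ = g.conn ⁅X, Y⁆ Z + g.conn Y ⁅X, Z⁆ := by
  refine lie_conn (D := g.conn) (act := act) (ip := g.ip) act_lie g.conn_sub_conn g.ip_comm
    g.act_ip (fun a ha => ?_) (fun _ => g.eq_zero_of_ip) hX Y Z
  ext q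
  have h : a.1 q + a.1 q = 0 := congrFun (congrArg Subtype.val ha) q
  change a.1 q = 0
  linarith

/-- A Killing field preserves the Ricci tensor. -/
lemma dirDeriv_ricci_of_killing
    (hX : ∀ Y Z, act X (g.ip Y Z) = g.ip ⁅X, Y⁆ Z + g.ip Y ⁅X, Z⁆)
    (Y Z : SmoothField E M) (p : M) :
    dirDeriv X.1 (fun q => g.ricci q (Y.1 q) (Z.1 q)) p
      = g.ricci p ((⁅X, Y⁆ : SmoothField E M).1 p) (Z.1 p)
        + g.ricci p (Y.1 p) ((⁅X, Z⁆ : SmoothField E M).1 p) := by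
  obtain ⟨e, e', hd⟩ := g.exists_smooth_dual_frame p
  have h := g.dirDeriv_trace (X := X) (Δ := AddMonoidHom.mk' (fun Y => ⁅X, Y⁆) (lie_add X))
    (L := fun U => curv g.conn U Y Z)
    (Lp := fun q => g.curvatureEnd q (Y.1 q) (Z.1 q)) hX
    (fun U q => (g.curvatureAt_apply U Y Z q).symm) hd
  simp only [← ricci_eq_trace] at h
  rw [h, g.ricci_eq_sum hd.self_of_nhds, g.ricci_eq_sum hd.self_of_nhds,
    ← Finset.sum_add_distrib]
  refine Finset.sum_congr rfl fun i _ => ?_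
  have h1 : ⁅X, curv g.conn (e i) Y Z⁆ - curv g.conn ⁅X, e i⁆ Y Z
      = curv g.conn (e i) ⁅X, Y⁆ Z + curv g.conn (e i) Y ⁅X, Z⁆ := by
    rw [lie_curv (g.lie_conn_of_killing hX)]
    abel
  change (g.ip (⁅X, curv g.conn (e i) Y Z⁆ - curv g.conn ⁅X, e i⁆ Y Z) (e' i)).1 p = _
  rw [h1, map_add]
  rfl

end killing

section hessian

variable {f : M → ℝ} (hf : ContMDiff 𝓘(ℝ, E) 𝓘(ℝ, ℝ) ∞ f)
include hf

/-- The gradient of a smooth function as a smooth field. -/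
noncomputable def gradField : SmoothField E M := ⟨g.grad f, g.isSmoothField_grad hf⟩

lemma hess_eq (p : M) (v w : TangentSpace 𝓘(ℝ, E) p) :
    g.hess f p v w = g.inner p (g.hessOp f p v) w := by
  have h : dirDeriv (ext w) f = g.pair (g.grad f) (ext w) := by
    funext q
    exact (g.inner_grad f q _).symm
  rw [hess, h, g.mvfderiv_pair ((g.isSmoothField_grad hf).mdifferentiableAt p)
    (ext_mdifferentiableAt w), inner_grad, ext_self, hessOp]
  ring

lemma ip_gradField (Z : SmoothField E M) : g.ip (g.gradField hf) Z = act Z ⟨f, hf⟩ := by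
  ext q
  exact g.inner_grad f q _

/-- The Hessian is symmetric. -/
lemma ip_conn_gradField_comm (Y Z : SmoothField E M) :
    g.ip (g.conn Y (g.gradField hf)) Z = g.ip (g.conn Z (g.gradField hf)) Y := by
  have h1 := g.act_ip Y (g.gradField hf) Z
  have h2 := g.act_ip Z (g.gradField hf) Y
  have h3 := act_lie Y Z ⟨f, hf⟩
  rw [← ip_gradField g hf, ← ip_gradField g hf, ← ip_gradField g hf, ← g.conn_sub_conn, map_sub,
    h1, h2] at h3
  linear_combination -h3

/-- The Hessian operator `v ↦ ∇_v ∇f` as a linear map. -/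
noncomputable def hessEnd (p : M) : TangentSpace 𝓘(ℝ, E) p →ₗ[ℝ] TangentSpace 𝓘(ℝ, E) p where
  toFun := g.hessOp f p
  map_add' := g.nabla_add_dir ((g.isSmoothField_grad hf).mdifferentiableAt p)
  map_smul' := g.nabla_smul_dir ((g.isSmoothField_grad hf).mdifferentiableAt p)

lemma inner_hessOp_comm (p : M) (v w : TangentSpace 𝓘(ℝ, E) p) :
    g.inner p (g.hessOp f p v) w = g.inner p (g.hessOp f p w) v := by
  obtain ⟨Y, rfl⟩ := exists_smoothField_apply_eq v
  obtain ⟨Z, rfl⟩ := exists_smoothField_apply_eq w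
  exact congrFun (congrArg Subtype.val (g.ip_conn_gradField_comm hf Y Z)) p

/-- `‖Hess_f‖² = tr (H_f ∘ H_f)`. -/
lemma normSq₂_hess (p : M) :
    g.normSq₂ p (g.hess f p) = LinearMap.trace ℝ _ (g.hessEnd hf p ∘ₗ g.hessEnd hf p) := by
  have hd := g.isDualPair_coframe p
  rw [hd.trace_eq, normSq₂]
  refine Finset.sum_congr rfl fun i _ => ?_
  change _ = g.inner p (g.hessOp f p (g.hessOp f p (frame E p i))) _
  rw [g.inner_hessOp_comm hf, g.symm, ← hd.sum_smul (g.hessOp f p (g.coframe p i)), map_sum]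
  refine Finset.sum_congr rfl fun j _ => ?_
  rw [map_smul, g.hess_eq hf, g.hess_eq hf, smul_eq_mul, mul_comm]

end hessian

end PseudoRiemannianMetric

/-! ### Gradient Ricci solitons of constant scalar curvature -/

namespace PseudoRiemannianMetric
open LieConnection

variable {E : Type*} [NormedAddCommGroup E] [NormedSpace ℝ E]
  {M : Type*} [TopologicalSpace M] [ChartedSpace E M] [IsManifold 𝓘(ℝ, E) ∞ M]

/-- A constant, as a smooth function. -/
def constFunction (c : ℝ) : SmoothFunction E M := ⟨fun _ => c, contMDiff_const⟩

lemma act_constFunction (X : SmoothField E M) (c : ℝ) : act X (constFunction c) = 0 := by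
  ext q
  change dirDeriv X.1 (fun _ => c) q = 0
  simp [dirDeriv, mvfderiv_const]

variable [FiniteDimensional ℝ E] [T2Space M] (g : PseudoRiemannianMetric E M)

section operator

variable {f : M → ℝ} (hf : ContMDiff 𝓘(ℝ, E) 𝓘(ℝ, ℝ) ∞ f) (c : ℝ)

/-- The operator `c - H_f` on smooth vector fields; it is the Ricci operator if `f` is the
potential function of a gradient Ricci soliton with constant `c`. -/
noncomputable def solitonOp : SmoothField E M →+ SmoothField E M :=
  AddMonoidHom.mk'
    (fun Y => (constFunction c : SmoothFunction E M) • Y - g.conn Y (g.gradField hf))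
    fun Y Y' => by
      rw [map_add, AddMonoidHom.add_apply, smul_add]
      abel

/-- The operator `c - H_f` on `T_p M`. -/
noncomputable def solitonEnd (p : M) : TangentSpace 𝓘(ℝ, E) p →ₗ[ℝ] TangentSpace 𝓘(ℝ, E) p :=
  c • LinearMap.id - g.hessEnd hf p

lemma solitonOp_apply (Y : SmoothField E M) (p : M) :
    (g.solitonOp hf c Y).1 p = g.solitonEnd hf c p (Y.1 p) := rfl

/-- The covariant derivative of the operator `c - H_f`. -/
noncomputable def covSolitonOp (X Y : SmoothField E M) : SmoothField E M :=
  g.conn X (g.solitonOp hf c Y) - g.solitonOp hf c (g.conn X Y)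

/-- The Ricci identity for the gradient of `f`. -/
lemma covSolitonOp_sub (X Y : SmoothField E M) :
    g.covSolitonOp hf c X Y - g.covSolitonOp hf c Y X = -curv g.conn X Y (g.gradField hf) := by
  have h (X Y : SmoothField E M) : g.covSolitonOp hf c X Y
      = g.conn (g.conn X Y) (g.gradField hf) - g.conn X (g.conn Y (g.gradField hf)) := by
    simp only [covSolitonOp, solitonOp, AddMonoidHom.mk'_apply, map_sub, conn_smul_right, act_constFunction,
      zero_smul]
    abel
  rw [h, h, curv, ← g.conn_sub_conn X Y, map_sub, AddMonoidHom.sub_apply]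
  abel

end operator

section soliton

variable {g} {f : M → ℝ} {c : ℝ} (h : g.IsGradientRicciSoliton f c)
include h

namespace IsGradientRicciSoliton

lemma ricci_eq (p : M) (v w : TangentSpace 𝓘(ℝ, E) p) :
    g.ricci p v w = g.inner p (g.solitonEnd h.contMDiff c p v) w := by
  have h1 := h.eq p v w
  rw [g.hess_eq h.contMDiff] at h1
  change _ = g.inner p (c • v - g.hessOp f p v) w
  rw [map_sub, map_smul, sub_apply, smul_apply, smul_eq_mul]
  linarith

lemma ricciOp_eq (p : M) (v : TangentSpace 𝓘(ℝ, E) p) :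
    g.ricciOp p v = g.solitonEnd h.contMDiff c p v := by
  refine g.eq_of_inner_eq fun w => ?_
  rw [ricciOp, g.inner_sharp, h.ricci_eq]
  constructor <;> intros <;> simp [h.ricci_eq]

lemma ricci_symm (p : M) (v w : TangentSpace 𝓘(ℝ, E) p) : g.ricci p v w = g.ricci p w v := by
  have h1 := h.eq p v w
  have h2 := h.eq p w v
  rw [g.hess_eq h.contMDiff] at h1 h2
  rw [g.inner_hessOp_comm h.contMDiff, g.symm p v] at h1
  linarith

lemma scalarCurvature_eq (p : M) :
    g.scalarCurvature p = LinearMap.trace ℝ _ (g.solitonEnd h.contMDiff c p) := by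
  rw [(isDualPair_coframe (g := g) p).trace_eq]
  simp only [scalarCurvature, h.ricci_eq]

lemma covRicci_eq (X Y Z : SmoothField E M) (p : M) :
    g.covRicci X.1 Y.1 Z.1 p = (g.ip (g.covSolitonOp h.contMDiff c X Y) Z).1 p := by
  have h1 : dirDeriv X.1 (fun q => g.ricci q (Y.1 q) (Z.1 q)) p
      = (g.ip (g.conn X (g.solitonOp h.contMDiff c Y)) Z).1 p
        + (g.ip (g.solitonOp h.contMDiff c Y) (g.conn X Z)).1 p := by
    refine Eq.trans ?_ (congrFun (congrArg Subtype.val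
      (g.act_ip X (g.solitonOp h.contMDiff c Y) Z)) p)
    simp only [h.ricci_eq]
    rfl
  rw [covRicci, h1, h.ricci_eq, h.ricci_eq, covSolitonOp, map_sub]
  change (_ : ℝ) + g.inner p _ _ - _ - g.inner p _ _ = (_ : ℝ) - _
  change (_ : ℝ) + g.inner p ((g.solitonOp h.contMDiff c Y).1 p) ((g.conn X Z).1 p)
    - (g.ip (g.solitonOp h.contMDiff c (g.conn X Y)) Z).1 p
    - g.inner p ((g.solitonOp h.contMDiff c Y).1 p) ((g.conn X Z).1 p) = _
  ring

/-- `X(τ)` is the contraction of `∇_X Ric`. -/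
lemma dirDeriv_scalarCurvature {p : M} {e e' : Fin (Module.finrank ℝ E) → SmoothField E M}
    (hd : ∀ᶠ q in 𝓝 p, g.IsDualPair (fun i => (e i).1 q) (fun i => (e' i).1 q))
    (X : SmoothField E M) :
    dirDeriv X.1 g.scalarCurvature p
      = ∑ i, (g.ip (g.covSolitonOp h.contMDiff c X (e i)) (e' i)).1 p := by
  rw [show g.scalarCurvature
      = fun q => LinearMap.trace ℝ _ (g.solitonEnd h.contMDiff c q) from
    funext h.scalarCurvature_eq]
  exact g.dirDeriv_trace (g.act_ip X) (fun Y q => g.solitonOp_apply h.contMDiff c Y q) hd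

lemma inner_curv_gradField (X Y Z : SmoothField E M) (p : M) :
    g.inner p ((curv g.conn X Y Z).1 p) (g.grad f p)
      = g.covRicci X.1 Y.1 Z.1 p - g.covRicci Y.1 X.1 Z.1 p := by
  rw [h.covRicci_eq, h.covRicci_eq]
  have h1 : g.ip (curv g.conn X Y Z) (g.gradField h.contMDiff)
      = g.ip (g.covSolitonOp h.contMDiff c X Y - g.covSolitonOp h.contMDiff c Y X) Z := by
    rw [covSolitonOp_sub, ip_curv_skew (D := g.conn) (act := act) (ip := g.ip) act_lie g.act_ip,
      map_neg, AddMonoidHom.neg_apply, g.ip_comm]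
  rw [map_sub] at h1
  exact congrFun (congrArg Subtype.val h1) p

variable {tau : ℝ} (htau : ∀ p, g.scalarCurvature p = tau)
include htau

lemma sum_covSolitonOp_eq_zero {p : M} {e e' : Fin (Module.finrank ℝ E) → SmoothField E M}
    (hd : ∀ᶠ q in 𝓝 p, g.IsDualPair (fun i => (e i).1 q) (fun i => (e' i).1 q))
    (X : SmoothField E M) :
    ∑ i, (g.ip (g.covSolitonOp h.contMDiff c X (e i)) (e' i)).1 p = 0 := by
  rw [← h.dirDeriv_scalarCurvature hd, show g.scalarCurvature = fun _ => tau from funext htau]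
  simp [dirDeriv, mvfderiv_const]

/-- The contraction `ρ(Y, ∇f) = Y(τ) - div Ric (Y)` of the formula for `R(X, Y) ∇f` vanishes, as
`2 div Ric = dτ = 0`. -/
lemma solitonOp_gradField : g.solitonOp h.contMDiff c (g.gradField h.contMDiff) = 0 := by
  refine g.eq_zero_of_ip fun Y => ?_
  ext p
  obtain ⟨e, e', hd⟩ := g.exists_smooth_dual_frame p
  have h0 := h.sum_covSolitonOp_eq_zero htau hd Y
  have h1 := g.contracted_bianchi hd Y
  simp only [h.covRicci_eq, h0] at h1
  have h2 := g.ricci_eq_sum hd.self_of_nhds Y (g.gradField h.contMDiff)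
  have h3 : ∀ i, (g.ip (curv g.conn (e i) Y (g.gradField h.contMDiff)) (e' i)).1 p
      = (g.ip (g.covSolitonOp h.contMDiff c Y (e i)) (e' i)).1 p
        - (g.ip (g.covSolitonOp h.contMDiff c (e i) Y) (e' i)).1 p := by
    intro i
    rw [← neg_neg (curv g.conn (e i) Y _), ← covSolitonOp_sub g h.contMDiff c, neg_sub, map_sub]
    rfl
  simp only [h3, Finset.sum_sub_distrib, h0] at h2
  rw [h.ricci_symm, h.ricci_eq] at h2
  change g.inner p (g.solitonEnd h.contMDiff c p ((g.gradField h.contMDiff).1 p)) (Y.1 p) = 0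
  linarith

/-- `∇_{∇f} Ric + Ric ∘ H_f = R(·, ∇f) ∇f`. -/
lemma covSolitonOp_gradField (Y : SmoothField E M) :
    g.covSolitonOp h.contMDiff c (g.gradField h.contMDiff) Y
        + g.solitonOp h.contMDiff c (g.conn Y (g.gradField h.contMDiff))
      = curv g.conn Y (g.gradField h.contMDiff) (g.gradField h.contMDiff) := by
  have h1 := g.covSolitonOp_sub h.contMDiff c (g.gradField h.contMDiff) Y
  rw [← curv_swap] at h1
  rw [← h1, covSolitonOp, covSolitonOp, h.solitonOp_gradField htau, map_zero]
  abel

/-- `∇_{∇f} ∇f = λ ∇f`. -/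
lemma hessOp_grad (p : M) : g.hessOp f p (g.grad f p) = c • g.grad f p := by
  have h1 : c • g.grad f p - g.hessOp f p (g.grad f p) = 0 :=
    congrFun (congrArg Subtype.val (h.solitonOp_gradField htau)) p
  exact (sub_eq_zero.1 h1).symm

lemma exists_norm_grad_sub_eq [ConnectedSpace M] :
    ∃ C : ℝ, ∀ p, g.inner p (g.grad f p) (g.grad f p) - 2 * c * f p = C := by
  have hG := g.isSmoothField_grad h.contMDiff
  have hs : CMDiff ∞ (g.pair (g.grad f) (g.grad f)) := g.pair_contMDiff hG hG
  have hc : CMDiff ∞ (fun _ : M => 2 * c) := contMDiff_const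
  refine exists_eq_const_of_mvfderiv_eq_zero
    (f := g.pair (g.grad f) (g.grad f) - (fun _ => 2 * c) * f) (hs.sub (hc.mul h.contMDiff))
    fun p => ?_
  have hfd : MDiffAt f p := h.contMDiff.mdifferentiable (by simp) p
  have hsd : MDiffAt (g.pair (g.grad f) (g.grad f)) p := hs.mdifferentiable (by simp) p
  have hcd : MDiffAt (fun _ : M => 2 * c) p := hc.mdifferentiable (by simp) p
  rw [mvfderiv_sub hsd (hcd.mul hfd), mvfderiv_mul hcd hfd, mvfderiv_const]
  ext v
  have h1 := g.mvfderiv_pair (hG.mdifferentiableAt p) (hG.mdifferentiableAt p) v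
  have h2 := g.inner_hessOp_comm h.contMDiff p v (g.grad f p)
  rw [h.hessOp_grad htau, map_smul, smul_apply, inner_grad, hessOp] at h2
  rw [g.symm p (g.grad f p), h2] at h1
  simp only [sub_apply, smul_apply, smul_eq_mul, h1, zero_apply, smul_zero, add_zero]
  ring

/-- The trace of the identity `covSolitonOp_gradField` is `tr (Ric ∘ H_f) = 0`, where
`Ric = λ - H_f`. -/
lemma normSq₂_hess_eq (p : M) :
    c * (Module.finrank ℝ E * c - tau) = g.normSq₂ p (g.hess f p) := by
  set F := g.gradField h.contMDiff with hF
  obtain ⟨e, e', hd⟩ := g.exists_smooth_dual_frame p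
  have hdp := hd.self_of_nhds
  have : FiniteDimensional ℝ (TangentSpace 𝓘(ℝ, E) p) := inferInstanceAs (FiniteDimensional ℝ E)
  have h0 := h.sum_covSolitonOp_eq_zero htau hd F
  have h1 : ∑ i, (g.ip (curv g.conn (e i) F F) (e' i)).1 p = 0 := by
    rw [← g.ricci_eq_sum hdp, h.ricci_eq, ← solitonOp_apply, h.solitonOp_gradField htau]
    change g.inner p 0 _ = 0
    simp
  have h2 : ∑ i, (g.ip (g.solitonOp h.contMDiff c (g.conn (e i) F)) (e' i)).1 p = 0 := by
    rw [← h1, ← add_zero (∑ i, _), ← h0, ← Finset.sum_add_distrib]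
    refine Finset.sum_congr rfl fun i _ => ?_
    rw [← h.covSolitonOp_gradField htau (e i), map_add, add_comm]
    rfl
  have h3 : LinearMap.trace ℝ _ (g.solitonEnd h.contMDiff c p ∘ₗ g.hessEnd h.contMDiff p) = 0 := by
    rw [hdp.trace_eq, ← h2]
    rfl
  have h4 : tau = Module.finrank ℝ E * c - LinearMap.trace ℝ _ (g.hessEnd h.contMDiff p) := by
    rw [← htau p, h.scalarCurvature_eq, solitonEnd, map_sub, map_smul, LinearMap.trace_id,
      smul_eq_mul, mul_comm c]
    rfl
  rw [solitonEnd, LinearMap.sub_comp, map_sub, LinearMap.smul_comp, LinearMap.id_comp, map_smul,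
    smul_eq_mul] at h3
  rw [g.normSq₂_hess h.contMDiff, h4]
  linarith

end IsGradientRicciSoliton

end soliton

end PseudoRiemannianMetric

/-! ### Killing fields on gradient Ricci solitons -/

namespace PseudoRiemannianMetric
open LieConnection

variable {E : Type*} [NormedAddCommGroup E] [NormedSpace ℝ E] [FiniteDimensional ℝ E]
  {M : Type*} [TopologicalSpace M] [ChartedSpace E M] [IsManifold 𝓘(ℝ, E) ∞ M]
  (g : PseudoRiemannianMetric E M)

lemma act_ip_of_isKilling {X : SmoothField E M} (hX : g.IsKilling X.1) (Y Z : SmoothField E M) :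
    act X (g.ip Y Z) = g.ip ⁅X, Y⁆ Z + g.ip Y ⁅X, Z⁆ := by
  ext p
  have h := hX.2 Y.1 Z.1 Y.2 Z.2 p
  change dirDeriv X.1 (g.pair Y.1 Z.1) p - g.pair ⁅X, Y⁆.1 Z.1 p - g.pair Y.1 ⁅X, Z⁆.1 p = 0 at h
  change dirDeriv X.1 (g.pair Y.1 Z.1) p = g.pair ⁅X, Y⁆.1 Z.1 p + g.pair Y.1 ⁅X, Z⁆.1 p
  linarith

variable [T2Space M]

section killing

variable {f : M → ℝ} (hf : ContMDiff 𝓘(ℝ, E) 𝓘(ℝ, ℝ) ∞ f) {X : SmoothField E M}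
  (hX : ∀ Y Z, act X (g.ip Y Z) = g.ip ⁅X, Y⁆ Z + g.ip Y ⁅X, Z⁆)
include hf hX

/-- The flow of a Killing field commutes with taking gradients. -/
lemma lie_gradField : ⁅X, g.gradField hf⁆ = g.gradField (dirDeriv_contMDiff X.2 hf) := by
  rw [← sub_eq_zero]
  refine g.eq_zero_of_ip fun Z => ?_
  have h1 := hX (g.gradField hf) Z
  have h2 := g.ip_gradField (dirDeriv_contMDiff X.2 hf) Z
  have h3 := act_lie X Z ⟨f, hf⟩
  change _ = act Z (act X ⟨f, hf⟩) at h2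
  rw [g.ip_gradField, g.ip_gradField] at h1
  rw [map_sub, AddMonoidHom.sub_apply, h2]
  linear_combination -h1 - h3

lemma lieDeriv_hess (Y Z : SmoothField E M) (p : M) :
    lieDeriv (g.hess f) X.1 Y.1 Z.1 p = g.hess (dirDeriv X.1 f) p (Y.1 p) (Z.1 p) := by
  have h1 : lieDeriv (g.hess f) X.1 Y.1 Z.1 p
      = (act X (g.ip (g.conn Y (g.gradField hf)) Z) - g.ip (g.conn ⁅X, Y⁆ (g.gradField hf)) Z
        - g.ip (g.conn Y (g.gradField hf)) ⁅X, Z⁆).1 p := by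
    simp only [lieDeriv, g.hess_eq hf]
    rfl
  rw [h1, g.hess_eq (dirDeriv_contMDiff X.2 hf)]
  have h2 : act X (g.ip (g.conn Y (g.gradField hf)) Z) - g.ip (g.conn ⁅X, Y⁆ (g.gradField hf)) Z
        - g.ip (g.conn Y (g.gradField hf)) ⁅X, Z⁆
      = g.ip (g.conn Y (g.gradField (dirDeriv_contMDiff X.2 hf))) Z := by
    rw [hX, g.lie_conn_of_killing hX, ← g.lie_gradField hf hX, map_add, AddMonoidHom.add_apply]
    ring
  rw [h2]
  rfl

end killing

namespace IsGradientRicciSoliton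

variable {g} {f : M → ℝ} {c : ℝ} (h : g.IsGradientRicciSoliton f c) {X : SmoothField E M}
  (hX : ∀ Y Z, act X (g.ip Y Z) = g.ip ⁅X, Y⁆ Z + g.ip Y ⁅X, Z⁆)
include h hX

/-- As a Killing field preserves `g` and `ρ`, it preserves `Hess_f = λ g - ρ`. -/
lemma lieDeriv_hess_eq_zero (Y Z : SmoothField E M) (p : M) :
    lieDeriv (g.hess f) X.1 Y.1 Z.1 p = 0 := by
  have h1 := g.dirDeriv_ricci_of_killing hX Y Z p
  have h2 := congrFun (congrArg Subtype.val (hX Y Z)) p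
  change dirDeriv X.1 (g.pair Y.1 Z.1) p = g.pair ⁅X, Y⁆.1 Z.1 p + g.pair Y.1 ⁅X, Z⁆.1 p at h2
  have h3 : ∀ q v w, g.ricci q v w = c * g.inner q v w - g.hess f q v w := fun q v w => by
    rw [← h.eq]; ring
  have hH : MDiffAt (fun q => g.hess f q (Y.1 q) (Z.1 q)) p := by
    simp only [g.hess_eq h.contMDiff]
    exact (g.ip (g.conn Y (g.gradField h.contMDiff)) Z).mdifferentiableAt p
  have hP : MDiffAt (g.pair Y.1 Z.1) p := (g.ip Y Z).mdifferentiableAt p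
  have hc : MDiffAt (fun _ : M => c) p := mdifferentiableAt_const
  have h4 : dirDeriv X.1 (fun q => g.ricci q (Y.1 q) (Z.1 q)) p
      = c * dirDeriv X.1 (g.pair Y.1 Z.1) p
        - dirDeriv X.1 (fun q => g.hess f q (Y.1 q) (Z.1 q)) p := by
    simp only [h3]
    change mvfderiv _ ((fun _ => c) * g.pair Y.1 Z.1 - fun q => g.hess f q (Y.1 q) (Z.1 q)) p _ = _
    rw [mvfderiv_sub (hc.mul hP) hH, mvfderiv_mul hc hP, mvfderiv_const]
    simp [dirDeriv]
  rw [h4, h2, h3, h3] at h1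
  rw [lieDeriv]
  change _ - g.hess f p (⁅X, Y⁆.1 p) _ - g.hess f p _ (⁅X, Z⁆.1 p) = 0
  simp only [pair] at h1
  linarith

lemma isParallel_grad : g.IsParallel (g.grad (dirDeriv X.1 f)) := by
  intro p v
  refine g.nondegenerate p _ fun w => ?_
  obtain ⟨Y, rfl⟩ := exists_smoothField_apply_eq v
  obtain ⟨Z, rfl⟩ := exists_smoothField_apply_eq w
  rw [← h.lieDeriv_hess_eq_zero hX Y Z p, g.lieDeriv_hess h.contMDiff hX,
    g.hess_eq (dirDeriv_contMDiff X.2 h.contMDiff), hessOp]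

/-- Apply `X` to the constant `‖∇f‖² - 2 λ f`: as `X` is Killing,
`X ‖∇f‖² = 2 g(∇(X f), ∇f) = 0`. -/
lemma dirDeriv_eq_zero [ConnectedSpace M] {tau : ℝ} (htau : ∀ p, g.scalarCurvature p = tau)
    (hc : c ≠ 0) (h0 : ∀ p, g.grad (dirDeriv X.1 f) p = 0) (p : M) : dirDeriv X.1 f p = 0 := by
  obtain ⟨C, hC⟩ := h.exists_norm_grad_sub_eq htau
  have h1 := congrFun (congrArg Subtype.val
    (hX (g.gradField h.contMDiff) (g.gradField h.contMDiff))) p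
  have h2 : ⁅X, g.gradField h.contMDiff⁆ = 0 := by
    rw [g.lie_gradField h.contMDiff hX]
    ext q
    exact h0 q
  have hfd : MDiffAt f p := h.contMDiff.mdifferentiable (by simp) p
  have hcd : MDiffAt (fun _ : M => 2 * c) p := mdifferentiableAt_const
  have hCd : MDiffAt (fun _ : M => C) p := mdifferentiableAt_const
  have h3 : g.pair (g.grad f) (g.grad f) = (fun _ => C) + (fun _ => 2 * c) * f := by
    funext q
    have := hC q
    simp only [pair, Pi.add_apply, Pi.mul_apply]
    linarith
  rw [h2, map_zero, map_zero, AddMonoidHom.zero_apply, add_zero] at h1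
  change dirDeriv X.1 (g.pair (g.grad f) (g.grad f)) p = 0 at h1
  rw [h3, dirDeriv_add hCd (hcd.mul hfd), dirDeriv_mul hcd hfd] at h1
  simpa [dirDeriv, mvfderiv_const, hc] using h1

end IsGradientRicciSoliton

end PseudoRiemannianMetric

theorem lemma2 {E : Type*} [NormedAddCommGroup E] [NormedSpace ℝ E] [FiniteDimensional ℝ E]
    {M : Type*} [TopologicalSpace M] [T2Space M] [ConnectedSpace M] [ChartedSpace E M]
    [IsManifold 𝓘(ℝ, E) ∞ M]
    (g : PseudoRiemannianMetric E M) (f : M → ℝ) (lam tau : ℝ)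
    (hsol : g.IsGradientRicciSoliton f lam)
    (htau : ∀ p, g.scalarCurvature p = tau) :
    -- identities for the potential function and the curvature
    ((∀ p, g.ricciOp p (g.grad f p) = 0) ∧
      (∃ C : ℝ, ∀ p, g.inner p (g.grad f p) (g.grad f p) - 2 * lam * f p = C) ∧
      (∀ X Y Z : Π p : M, TangentSpace 𝓘(ℝ, E) p,
        PseudoRiemannianMetric.IsSmoothField X → PseudoRiemannianMetric.IsSmoothField Y →
        PseudoRiemannianMetric.IsSmoothField Z → ∀ p,
          g.inner p (g.curvature X Y Z p) (g.grad f p) = g.covRicci X Y Z p - g.covRicci Y X Z p) ∧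
      (∀ Y : Π p : M, TangentSpace 𝓘(ℝ, E) p, PseudoRiemannianMetric.IsSmoothField Y → ∀ p,
        g.covRicciOp (g.grad f) Y p + g.ricciOp p (g.hessOp f p (Y p))
          = g.curvature Y (g.grad f) (g.grad f) p)) ∧
    -- Killing vector fields
    (∀ X : Π p : M, TangentSpace 𝓘(ℝ, E) p, g.IsKilling X →
      (∀ Y Z : Π p : M, TangentSpace 𝓘(ℝ, E) p,
        PseudoRiemannianMetric.IsSmoothField Y → PseudoRiemannianMetric.IsSmoothField Z → ∀ p,
          PseudoRiemannianMetric.lieDeriv (g.hess f) X Y Z p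
            = g.hess (PseudoRiemannianMetric.dirDeriv X f) p (Y p) (Z p)) ∧
      g.IsParallel (g.grad (PseudoRiemannianMetric.dirDeriv X f)) ∧
      (lam ≠ 0 → ((∀ p, g.grad (PseudoRiemannianMetric.dirDeriv X f) p = 0) ↔
        ∀ p, PseudoRiemannianMetric.dirDeriv X f p = 0))) ∧
    -- the norm of the Hessian
    (∀ p, lam * (Module.finrank ℝ E * lam - tau) = g.normSq₂ p (g.hess f p)) ∧
    -- isotropic non-steady solitons
    ((∀ p, g.inner p (g.grad f p) (g.grad f p) = 0) → lam ≠ 0 → g.IsEinstein lam) ∧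
    -- steady solitons
    (lam = 0 → (∀ p, g.normSq₂ p (g.hess f p) = 0) ∧
      ∃ μ : ℝ, ∀ p, g.inner p (g.grad f p) (g.grad f p) = μ) := by
  have hf := hsol.contMDiff
  refine ⟨⟨fun p => ?_, hsol.exists_norm_grad_sub_eq htau, fun X Y Z hX hY hZ p => ?_,
    fun Y hY p => ?_⟩, fun X hX => ?_, hsol.normSq₂_hess_eq htau, fun hn hlam => ?_,
    fun hlam => ⟨fun p => ?_, ?_⟩⟩
  · rw [hsol.ricciOp_eq]
    exact congrFun (congrArg Subtype.val (hsol.solitonOp_gradField htau)) p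
  · exact hsol.inner_curv_gradField ⟨X, hX⟩ ⟨Y, hY⟩ ⟨Z, hZ⟩ p
  · have h := congrFun (congrArg Subtype.val (hsol.covSolitonOp_gradField htau ⟨Y, hY⟩)) p
    simp only [PseudoRiemannianMetric.covRicciOp, hsol.ricciOp_eq]
    exact h
  · let K : PseudoRiemannianMetric.SmoothField E M := ⟨X, hX.1⟩
    have hK := g.act_ip_of_isKilling (X := K) hX
    have hL := g.lieDeriv_hess hf (X := K) hK
    have hP := hsol.isParallel_grad (X := K) hK
    have hZ := hsol.dirDeriv_eq_zero (X := K) hK htau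
    refine ⟨fun Y Z hY hZ p => hL ⟨Y, hY⟩ ⟨Z, hZ⟩ p, hP, fun hlam => ⟨hZ hlam, fun h0 p => ?_⟩⟩
    refine g.nondegenerate p _ fun w => ?_
    rw [g.inner_grad, show PseudoRiemannianMetric.dirDeriv X f = fun _ => 0 from funext h0,
      mvfderiv_const]
    rfl
  · -- `‖∇f‖² - 2 λ f` is constant, so `f` is, and its Hessian vanishes
    obtain ⟨C, hC⟩ := hsol.exists_norm_grad_sub_eq htau
    have hconst : f = fun _ => -C / (2 * lam) := by
      funext p
      have h := hC p
      rw [hn, zero_sub] at h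
      field_simp
      linarith
    have hgrad : g.grad f = 0 := by
      funext p
      refine g.nondegenerate p _ fun w => ?_
      rw [g.inner_grad, hconst, mvfderiv_const]
      rfl
    intro p v w
    have hF : g.gradField hf = 0 := Subtype.ext hgrad
    obtain ⟨Y, rfl⟩ := PseudoRiemannianMetric.exists_smoothField_apply_eq v
    have hH : g.hessOp f p (Y.1 p) = 0 := by
      change (g.conn Y (g.gradField hf)).1 p = 0
      rw [hF, map_zero]
      rfl
    rw [← hsol.eq, g.hess_eq hf, hH, map_zero]
    simp
  · rw [← hsol.normSq₂_hess_eq htau, hlam, zero_mul]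
  · obtain ⟨C, hC⟩ := hsol.exists_norm_grad_sub_eq htau
    exact ⟨C, fun p => by simpa [hlam] using hC p⟩
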